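/- **The calculus $F_{<:A}$.** Write $\mathsf{sync}=\bot$ and $\mathsf{async}=\top$ for the elements of the two-point lattice of *colours* $C$. Let $Y$, $X$, $x$ range over qualifier, type and term variables. The syntax (up to renaming of bound variables) is - qualifiers $P,Q,R,B ::= Y \mid \mathsf{sync}\mid \mathsf{async}\mid Q\wedge R\mid Q\vee R$; - simple types $S,U ::= \top \mid X\mid T_1\to T_2\mid \forall(X<:S).T\mid \forall(Y<:Q).T$, and qualified types $T ::= \{Q\}\,S$; - values $v ::= \lambda(x)_P.t\mid \Lambda(X<:S)_P.t\mid\Lambda(Y<:Q)_P.t$ (the qualifier $P$ is the *tag* of the value, and lies outside the scope of the binder); - terms $s,t ::= x\mid v\mid s(t)\mid s[S]\mid s\{Q\}\mid \mathsf{assert}\,Q\,s\mid\mathsf{upqual}\,Q\,s$; - environments $\Gamma ::= \varnothing\mid\Gamma,x:T\mid \Gamma,X<:S\mid\Gamma,Y<:Q$. All expressions are assumed well scoped. $\mathrm{eval}(Q)$ is the colour obtained by computing the meets and joins in $Q$; it is undefined if a variable occurs in $Q$. *Subqualification* $\Gamma\vdash Q<:R$ is generated by: $Q<:\mathsf{async}$;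 $\mathsf{sync}<:Q$; $Y<:Y$; $Y<:R$ if $(Y<:Q)\in\Gamma$ and $Q<:R$; $Q_1\wedge Q_2<:R$ if $Q_1<:R$ or $Q_2<:R$; $Q<:R_1\wedge R_2$ if $Q<:R_1$ and $Q<:R_2$; $Q<:R_1\vee R_2$ if $Q<:R_1$ or $Q<:R_2$; $Q_1\vee Q_2<:R$ if $Q_1<:R$ and $Q_2<:R$. *Subtyping* is generated by: $\{Q_1\}S_1<:\{Q_2\}S_2$ if $Q_1<:Q_2$ and $S_1<:S_2$; $S<:\top$; $X<:X$; $X<:S$ if $(X<:U)\in\Gamma$ and $U<:S$; $T_1\to T_2<:T_1'\to T_2'$ if $T_1'<:T_1$ and $T_2<:T_2'$; $\Gamma\vdash\forall(X<:U_1).T_1<:\forall(X<:U_2).T_2$ if $\Gamma\vdash U_2<:U_1$ and $\Gamma,X<:U_2\vdash T_1<:T_2$; and likewise for $\forall(Y<:Q).T$. *Typing* $\Gamma\mid R\vdash t:T$, where the qualifier $R$ is the colour context, is generated by: - $\Gamma\mid R\vdash x:T$ if $(x:T)\in\Gamma$; - if $\Gamma,x:T_1\mid P\vdash t:T_2$,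 then $\Gamma\mid R\vdash\lambda(x)_P.t:\{P\}(T_1\to T_2)$; - if $\Gamma,X<:S\mid P\vdash t:T$, then $\Gamma\mid R\vdash\Lambda(X<:S)_P.t:\{P\}\forall(X<:S).T$; and likewise for $\Lambda(Y<:Q)_P.t$; - if $\Gamma\mid R\vdash s:\{R\}(T_1\to T_2)$ and $\Gamma\mid R\vdash t:T_1$, then $\Gamma\mid R\vdash s(t):T_2$; - if $\Gamma\mid R\vdash s:\{R\}\forall(X<:S).T$ and $\Gamma\vdash S'<:S$, then $\Gamma\mid R\vdash s[S']:T[X\mapsto S']$; - if $\Gamma\mid R\vdash s:\{R\}\forall(Y<:Q).T$ and $\Gamma\vdash Q'<:Q$, then $\Gamma\mid R\vdash s\{Q'\}:T[Y\mapsto Q']$; - if $\Gamma\mid R\vdash s:\{Q\}S$, then $\Gamma\mid R\vdash\mathsf{assert}\,Q\,s:\{Q\}S$, and $\Gamma\mid R\vdash\mathsf{upqual}\,Q'\,s:\{Q'\}S$ whenever $\Gamma\vdash Q<:Q'$; - subsumption: if $\Gamma\mid R\vdash t:T$, $\Gamma\vdash T<:T'$ and $\Gamma\vdash R<:R'$,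 then $\Gamma\mid R\vdash t:T'$ and $\Gamma\mid R'\vdash t:T$. **The machine.** A configuration $\langle c,\kappa\rangle$ consists of a closed term $c$ and a continuation $\kappa$, a finite stack (innermost first) of frames $\square(t)$, $v(\square)$, $\square[S]$, $\square\{Q\}$, $\mathsf{assert}\,Q\,\square$, $\mathsf{upqual}\,Q\,\square$ and $\mathsf{barrier}\,C$, all closed. A colour $C$ is *compatible* with $\kappa$ if $C\sqsubseteq D$ for every frame $\mathsf{barrier}\,D$ in $\kappa$. The steps are: - $\langle s(t),\kappa\rangle\to\langle s,\square(t)::\kappa\rangle$, and likewise $s[S]$, $s\{Q\}$, $\mathsf{assert}\,Q\,s$, $\mathsf{upqual}\,Q\,s$ push their frame and continue with $s$; $\langle v,\square(t)::\kappa\rangle\to\langle t,v(\square)::\kappa\rangle$; - calls: if $\mathrm{eval}(P)=C$ and $C$ is compatible with $\kappa$, then $\langle v,(\lambda(x)_P.t)(\square)::\kappa\rangle\to\langle t[x\mapsto v],\mathsf{barrier}\,C::\kappa\rangle$, $\langle\Lambda(X<:U)_P.t,\square[S]::\kappa\rangle\to\langle t[X\mapsto S],\mathsf{barrier}\,C::\kappa\rangle$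 and $\langle\Lambda(Y<:B)_P.t,\square\{Q\}::\kappa\rangle\to\langle t[Y\mapsto Q],\mathsf{barrier}\,C::\kappa\rangle$; - if $v$ has tag $P$ and $\mathrm{eval}(P)\sqsubseteq\mathrm{eval}(Q)$ (both defined), then $\langle v,\mathsf{assert}\,Q\,\square::\kappa\rangle\to\langle v,\kappa\rangle$ and $\langle v,\mathsf{upqual}\,Q\,\square::\kappa\rangle\to\langle v',\kappa\rangle$, where $v'$ is $v$ with its tag replaced by $Q$; - $\langle v,\mathsf{barrier}\,C::\kappa\rangle\to\langle v,\kappa\rangle$. *Continuation typing* $R\vdash\kappa:T\Rightarrow A$ (in the empty environment) is generated by: - $R\vdash[\,]:T\Rightarrow T$; - $R\vdash\square(t)::\kappa:\{R\}(T_1\to T_2)\Rightarrow A$ if $\varnothing\mid R\vdash t:T_1$ and $R\vdash\kappa:T_2\Rightarrow A$; - $R\vdash v(\square)::\kappa:T_1\Rightarrow A$ if $\varnothing\mid R\vdash v:\{R\}(T_1\to T_2)$ and $R\vdash\kappa:T_2\Rightarrow A$; - $R\vdash\square[S']::\kappa:\{R\}\forall(X<:S).T\Rightarrow A$ if $S'<:S$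 and $R\vdash\kappa:T[X\mapsto S']\Rightarrow A$; and likewise for $\square\{Q'\}$; - $R\vdash\mathsf{assert}\,Q\,\square::\kappa:\{Q\}S\Rightarrow A$ if $R\vdash\kappa:\{Q\}S\Rightarrow A$; - $R\vdash\mathsf{upqual}\,Q'\,\square::\kappa:\{Q\}S\Rightarrow A$ if $Q<:Q'$ and $R\vdash\kappa:\{Q'\}S\Rightarrow A$; - $C\vdash\mathsf{barrier}\,C::\kappa:T\Rightarrow A$ if $C<:R$ and $R\vdash\kappa:T\Rightarrow A$; - $R\vdash\kappa:T\Rightarrow A$ if $T<:T'$ and $R\vdash\kappa:T'\Rightarrow A$. A configuration $\langle c,\kappa\rangle$ is *well typed with answer type $A$* if there are $R$ and $T$ with $\varnothing\mid R\vdash c:T$ and $R\vdash\kappa:T\Rightarrow A$; it is *well typed* if this holds for some $A$. **Theorem (Preservation of $F_{<:A}$).** 1. If $\langle c,\kappa\rangle$ is well typed and $\langle c,\kappa\rangle\to\langle c',\kappa'\rangle$, then $\langle c',\kappa'\rangle$ is well typed. 2. More precisely, if $\langle c,\kappa\rangle$ is well typed with answer type $A$, then so is $\langle c',\kappa'\rangle$.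 3. An asynchronous function is never called beneath a synchronous barrier: let $\gamma$ be a well-typed configuration and $\gamma\to^*\gamma'$, where a function with tag $P$ is about to be called in $\gamma'$ on top of the continuation $\kappa$, i.e. $\gamma'$ is $\langle v,(\lambda(x)_P.t)(\square)::\kappa\rangle$, $\langle\Lambda(X<:U)_P.t,\square[S]::\kappa\rangle$ or $\langle\Lambda(Y<:B)_P.t,\square\{Q\}::\kappa\rangle$ (whether or not the machine permits the call). If $\mathrm{eval}(P)=\mathsf{async}$, then $\kappa$ contains no frame $\mathsf{barrier}\;\mathsf{sync}$. -/

import Mathlib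

/-!
The calculus F<:A (System F<: with synchronicity qualifiers) and its CK machine with barriers.

All expressions are intrinsically scoped de Bruijn expressions. There are three separate kinds of
variables: qualifier variables `Y` (`n` of them in scope), simple-type variables `X` (`m` in scope)
and term variables `x` (`k` in scope). An expression over a scope is therefore automatically
well formed in every environment with that scope.
-/

namespace FsubA

/-! ### Qualifiers -/

/-- The two concrete colours. `sync` is the bottom and `async` the top of the two-point lattice. -/
inductive Colour : Type
  | sync
  | async

namespace Colour

/-- The order of the two-point lattice: everything except `async ⊑ sync`. -/
inductive Le : Colour → Colour → Prop
  | sync_le (C : Colour) : Le sync C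
  | le_async (C : Colour) : Le C async

def meet : Colour → Colour → Colour
  | async, C => C
  | sync, _ => sync

def join : Colour → Colour → Colour
  | async, _ => async
  | sync, C => C

end Colour

/-- Qualifier expressions `P, Q, R ::= Y | sync (⊥) | async (⊤) | Q ∧ R | Q ∨ R`. -/
inductive Qual : ℕ → Type
  | var {n : ℕ} (Y : Fin n) : Qual n
  | sync {n : ℕ} : Qual n
  | async {n : ℕ} : Qual n
  | meet {n : ℕ} (Q R : Qual n) : Qual n
  | join {n : ℕ} (Q R : Qual n) : Qual n

def Colour.toQual {n : ℕ} : Colour → Qual n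
  | sync => Qual.sync
  | async => Qual.async

/-- Lifting of a renaming under one binder. -/
def liftRen {n n' : ℕ} (ρ : Fin n → Fin n') : Fin (n + 1) → Fin (n' + 1) :=
  Fin.cases 0 (fun i => (ρ i).succ)

namespace Qual

/-- Evaluation of a qualifier expression to a concrete colour, undefined on variables. -/
def eval {n : ℕ} : Qual n → Option Colour
  | var _ => none
  | sync => some Colour.sync
  | async => some Colour.async
  | meet Q R => do
      let C ← Q.eval
      let D ← R.eval
      return C.meet D
  | join Q R => do
      let C ← Q.eval
      let D ← R.eval
      return C.join D

def rename {n n' : ℕ} (ρ : Fin n → Fin n') : Qual n → Qual n'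
  | var Y => var (ρ Y)
  | sync => sync
  | async => async
  | meet Q R => meet (Q.rename ρ) (R.rename ρ)
  | join Q R => join (Q.rename ρ) (R.rename ρ)

/-- Weakening by one qualifier variable. -/
def shift {n : ℕ} (Q : Qual n) : Qual (n + 1) := Q.rename Fin.succ

def subst {n n' : ℕ} (σ : Fin n → Qual n') : Qual n → Qual n'
  | var Y => σ Y
  | sync => sync
  | async => async
  | meet Q R => meet (Q.subst σ) (R.subst σ)
  | join Q R => join (Q.subst σ) (R.subst σ)

/-- Lifting of a substitution under a qualifier binder. -/
def liftSub {n n' : ℕ} (σ : Fin n → Qual n') : Fin (n + 1) → Qual (n' + 1) :=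
  Fin.cases (var 0) (fun i => (σ i).shift)

/-- The substitution `[Y ↦ Q]` of the last qualifier variable. -/
def single {n : ℕ} (Q : Qual n) : Fin (n + 1) → Qual n := Fin.cases Q var

end Qual

/-! ### Types -/

/-- Simple types `S ::= ⊤ | X | T₁ → T₂ | ∀(X <: S).T | ∀(Y <: Q).T`. The qualified types `T`
below arrows and quantifiers are written out as a qualifier followed by a simple type. -/
inductive STy : ℕ → ℕ → Type
  | top {n m : ℕ} : STy n m
  | var {n m : ℕ} (X : Fin m) : STy n m
  | arrow {n m : ℕ} (Q₁ : Qual n) (S₁ : STy n m) (Q₂ : Qual n) (S₂ : STy n m) : STy n m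
  | all {n m : ℕ} (U : STy n m) (Q : Qual n) (S : STy n (m + 1)) : STy n m
  | qall {n m : ℕ} (B : Qual n) (Q : Qual (n + 1)) (S : STy (n + 1) m) : STy n m

namespace STy

def rename {n n' m m' : ℕ} (ρ : Fin n → Fin n') (ξ : Fin m → Fin m') : STy n m → STy n' m'
  | top => top
  | var X => var (ξ X)
  | arrow Q₁ S₁ Q₂ S₂ =>
      arrow (Q₁.rename ρ) (S₁.rename ρ ξ) (Q₂.rename ρ) (S₂.rename ρ ξ)
  | all U Q S => all (U.rename ρ ξ) (Q.rename ρ) (S.rename ρ (liftRen ξ))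
  | qall B Q S => qall (B.rename ρ) (Q.rename (liftRen ρ)) (S.rename (liftRen ρ) ξ)

/-- Weakening by one type variable. -/
def shiftT {n m : ℕ} (S : STy n m) : STy n (m + 1) := S.rename id Fin.succ

/-- Weakening by one qualifier variable. -/
def shiftQ {n m : ℕ} (S : STy n m) : STy (n + 1) m := S.rename Fin.succ id

/-- Lifting of a type substitution under a type binder. -/
def liftSub {n m m' : ℕ} (τ : Fin m → STy n m') : Fin (m + 1) → STy n (m' + 1) :=
  Fin.cases (var 0) (fun i => (τ i).shiftT)

/-- Simultaneous substitution of qualifiers for qualifier variables and of simple types for type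
variables. -/
def subst {n n' m m' : ℕ} (σ : Fin n → Qual n') (τ : Fin m → STy n' m') : STy n m → STy n' m'
  | top => top
  | var X => τ X
  | arrow Q₁ S₁ Q₂ S₂ =>
      arrow (Q₁.subst σ) (S₁.subst σ τ) (Q₂.subst σ) (S₂.subst σ τ)
  | all U Q S => all (U.subst σ τ) (Q.subst σ) (S.subst σ (liftSub τ))
  | qall B Q S =>
      qall (B.subst σ) (Q.subst (Qual.liftSub σ))
        (S.subst (Qual.liftSub σ) (fun i => (τ i).shiftQ))

/-- The substitution `[X ↦ U]` of the last type variable. -/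
def single {n m : ℕ} (U : STy n m) : Fin (m + 1) → STy n m := Fin.cases U var

/-- `S[X ↦ U]`. -/
def instT {n m : ℕ} (S : STy n (m + 1)) (U : STy n m) : STy n m := S.subst Qual.var (single U)

/-- `S[Y ↦ Q]`. -/
def instQ {n m : ℕ} (S : STy (n + 1) m) (Q : Qual n) : STy n m := S.subst (Qual.single Q) var

end STy

/-- Qualified types `T ::= {Q} S`. -/
structure QTy (n m : ℕ) : Type where
  q : Qual n
  s : STy n m

namespace QTy

def shiftT {n m : ℕ} (T : QTy n m) : QTy n (m + 1) := ⟨T.q, T.s.shiftT⟩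

def shiftQ {n m : ℕ} (T : QTy n m) : QTy (n + 1) m := ⟨T.q.shift, T.s.shiftQ⟩

end QTy

/-! ### Terms -/

/-- Terms
`s, t ::= x | λ(x)_P. t | Λ(X <: S)_P. t | Λ(Y <: Q)_P. t | s(t) | s[S] | s{Q} | assert Q s | upqual Q s`.
Each abstraction carries its qualifier tag `P`, which lives outside the scope of its binder. -/
inductive Tm : ℕ → ℕ → ℕ → Type
  | var {n m k : ℕ} (x : Fin k) : Tm n m k
  | lam {n m k : ℕ} (P : Qual n) (t : Tm n m (k + 1)) : Tm n m k
  | tlam {n m k : ℕ} (P : Qual n) (S : STy n m) (t : Tm n (m + 1) k) : Tm n m k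
  | qlam {n m k : ℕ} (P : Qual n) (Q : Qual n) (t : Tm (n + 1) m k) : Tm n m k
  | app {n m k : ℕ} (s t : Tm n m k) : Tm n m k
  | tapp {n m k : ℕ} (s : Tm n m k) (S : STy n m) : Tm n m k
  | qapp {n m k : ℕ} (s : Tm n m k) (Q : Qual n) : Tm n m k
  | assertQ {n m k : ℕ} (Q : Qual n) (s : Tm n m k) : Tm n m k
  | upqual {n m k : ℕ} (Q : Qual n) (s : Tm n m k) : Tm n m k

namespace Tm

def rename {n n' m m' k k' : ℕ} (ρ : Fin n → Fin n') (ξ : Fin m → Fin m') (ζ : Fin k → Fin k') :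
    Tm n m k → Tm n' m' k'
  | var x => var (ζ x)
  | lam P t => lam (P.rename ρ) (t.rename ρ ξ (liftRen ζ))
  | tlam P S t => tlam (P.rename ρ) (S.rename ρ ξ) (t.rename ρ (liftRen ξ) ζ)
  | qlam P Q t => qlam (P.rename ρ) (Q.rename ρ) (t.rename (liftRen ρ) ξ ζ)
  | app s t => app (s.rename ρ ξ ζ) (t.rename ρ ξ ζ)
  | tapp s S => tapp (s.rename ρ ξ ζ) (S.rename ρ ξ)
  | qapp s Q => qapp (s.rename ρ ξ ζ) (Q.rename ρ)
  | assertQ Q s => assertQ (Q.rename ρ) (s.rename ρ ξ ζ)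
  | upqual Q s => upqual (Q.rename ρ) (s.rename ρ ξ ζ)

/-- Lifting of a term substitution under a term binder. -/
def liftSub {n m k k' : ℕ} (υ : Fin k → Tm n m k') : Fin (k + 1) → Tm n m (k' + 1) :=
  Fin.cases (var 0) (fun i => (υ i).rename id id Fin.succ)

/-- Simultaneous capture-avoiding substitution for all three kinds of variables. -/
def subst {n n' m m' k k' : ℕ} (σ : Fin n → Qual n') (τ : Fin m → STy n' m')
    (υ : Fin k → Tm n' m' k') : Tm n m k → Tm n' m' k'
  | var x => υ x
  | lam P t => lam (P.subst σ) (t.subst σ τ (liftSub υ))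
  | tlam P S t =>
      tlam (P.subst σ) (S.subst σ τ)
        (t.subst σ (STy.liftSub τ) (fun i => (υ i).rename id Fin.succ id))
  | qlam P Q t =>
      qlam (P.subst σ) (Q.subst σ)
        (t.subst (Qual.liftSub σ) (fun i => (τ i).shiftQ)
          (fun i => (υ i).rename Fin.succ id id))
  | app s t => app (s.subst σ τ υ) (t.subst σ τ υ)
  | tapp s S => tapp (s.subst σ τ υ) (S.subst σ τ)
  | qapp s Q => qapp (s.subst σ τ υ) (Q.subst σ)
  | assertQ Q s => assertQ (Q.subst σ) (s.subst σ τ υ)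
  | upqual Q s => upqual (Q.subst σ) (s.subst σ τ υ)

/-- `t[x ↦ v]`. -/
def inst {n m k : ℕ} (t : Tm n m (k + 1)) (v : Tm n m k) : Tm n m k :=
  t.subst Qual.var STy.var (Fin.cases v var)

/-- `t[X ↦ S]`. -/
def instT {n m k : ℕ} (t : Tm n (m + 1) k) (S : STy n m) : Tm n m k :=
  t.subst Qual.var (STy.single S) var

/-- `t[Y ↦ Q]`. -/
def instQ {n m k : ℕ} (t : Tm (n + 1) m k) (Q : Qual n) : Tm n m k :=
  t.subst (Qual.single Q) STy.var var

/-- The values are the three kinds of abstractions. -/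
inductive IsValue : {n m k : ℕ} → Tm n m k → Prop
  | lam {n m k : ℕ} (P : Qual n) (t : Tm n m (k + 1)) : IsValue (lam P t)
  | tlam {n m k : ℕ} (P : Qual n) (S : STy n m) (t : Tm n (m + 1) k) : IsValue (tlam P S t)
  | qlam {n m k : ℕ} (P : Qual n) (Q : Qual n) (t : Tm (n + 1) m k) : IsValue (qlam P Q t)

/-- The qualifier tag of a value (`none` on terms that are not values). -/
def tag {n m k : ℕ} : Tm n m k → Option (Qual n)
  | lam P _ => some P
  | tlam P _ _ => some P
  | qlam P _ _ => some P
  | _ => none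

/-- Replacement of the qualifier tag of a value (terms that are not values are unchanged). -/
def retag {n m k : ℕ} (Q : Qual n) : Tm n m k → Tm n m k
  | lam _ t => lam Q t
  | tlam _ S t => tlam Q S t
  | qlam _ B t => qlam Q B t
  | t => t

end Tm

/-! ### Environments -/

/-- Environments `Γ ::= ∅ | Γ, x : T | Γ, X <: S | Γ, Y <: Q`. -/
inductive Env : ℕ → ℕ → ℕ → Type
  | empty : Env 0 0 0
  | term {n m k : ℕ} (Γ : Env n m k) (T : QTy n m) : Env n m (k + 1)
  | type {n m k : ℕ} (Γ : Env n m k) (S : STy n m) : Env n (m + 1) k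
  | qual {n m k : ℕ} (Γ : Env n m k) (Q : Qual n) : Env (n + 1) m k

namespace Env

/-- The bound of a qualifier variable, weakened to the whole environment:
`Y <: Q ∈ Γ` means `Γ.qbound Y = Q`. -/
def qbound : {n m k : ℕ} → Env n m k → Fin n → Qual n
  | _, _, _, empty => fun Y => Y.elim0
  | _, _, _, term Γ _ => Γ.qbound
  | _, _, _, type Γ _ => Γ.qbound
  | _, _, _, qual Γ Q => Fin.cases Q.shift (fun Y => (Γ.qbound Y).shift)

/-- The bound of a type variable, weakened to the whole environment. -/
def tbound : {n m k : ℕ} → Env n m k → Fin m → STy n m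
  | _, _, _, empty => fun X => X.elim0
  | _, _, _, term Γ _ => Γ.tbound
  | _, _, _, type Γ S => Fin.cases S.shiftT (fun X => (Γ.tbound X).shiftT)
  | _, _, _, qual Γ _ => fun X => (Γ.tbound X).shiftQ

/-- The type of a term variable, weakened to the whole environment. -/
def typeOf : {n m k : ℕ} → Env n m k → Fin k → QTy n m
  | _, _, _, empty => fun x => x.elim0
  | _, _, _, term Γ T => Fin.cases T Γ.typeOf
  | _, _, _, type Γ _ => fun x => (Γ.typeOf x).shiftT
  | _, _, _, qual Γ _ => fun x => (Γ.typeOf x).shiftQ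

end Env

/-! ### Subqualification and subtyping -/

/-- Subqualification `Γ ⊢ Q <: R`. -/
inductive SubQual {n m k : ℕ} (Γ : Env n m k) : Qual n → Qual n → Prop
  | top (Q : Qual n) : SubQual Γ Q Qual.async
  | bot (Q : Qual n) : SubQual Γ Qual.sync Q
  | reflVar (Y : Fin n) : SubQual Γ (Qual.var Y) (Qual.var Y)
  | var {Y : Fin n} {R : Qual n} :
      SubQual Γ (Γ.qbound Y) R → SubQual Γ (Qual.var Y) R
  | meetElim₁ {Q₁ Q₂ R : Qual n} : SubQual Γ Q₁ R → SubQual Γ (Qual.meet Q₁ Q₂) R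
  | meetElim₂ {Q₁ Q₂ R : Qual n} : SubQual Γ Q₂ R → SubQual Γ (Qual.meet Q₁ Q₂) R
  | meetIntro {Q R₁ R₂ : Qual n} :
      SubQual Γ Q R₁ → SubQual Γ Q R₂ → SubQual Γ Q (Qual.meet R₁ R₂)
  | joinIntro₁ {Q R₁ R₂ : Qual n} : SubQual Γ Q R₁ → SubQual Γ Q (Qual.join R₁ R₂)
  | joinIntro₂ {Q R₁ R₂ : Qual n} : SubQual Γ Q R₂ → SubQual Γ Q (Qual.join R₁ R₂)
  | joinElim {Q₁ Q₂ R : Qual n} :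
      SubQual Γ Q₁ R → SubQual Γ Q₂ R → SubQual Γ (Qual.join Q₁ Q₂) R

/-- Subtyping `Γ ⊢ S₁ <: S₂` of simple types. Wherever qualified types are compared, both the
qualifiers and the simple types are, as in `QSub`. -/
inductive Sub : {n m k : ℕ} → Env n m k → STy n m → STy n m → Prop
  | top {n m k : ℕ} {Γ : Env n m k} (S : STy n m) : Sub Γ S STy.top
  | reflVar {n m k : ℕ} {Γ : Env n m k} (X : Fin m) : Sub Γ (STy.var X) (STy.var X)
  | var {n m k : ℕ} {Γ : Env n m k} {X : Fin m} {S : STy n m} :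
      Sub Γ (Γ.tbound X) S → Sub Γ (STy.var X) S
  | arrow {n m k : ℕ} {Γ : Env n m k} {Q₁ Q₂ R₁ R₂ : Qual n} {S₁ S₂ U₁ U₂ : STy n m} :
      SubQual Γ R₁ Q₁ → Sub Γ U₁ S₁ → SubQual Γ Q₂ R₂ → Sub Γ S₂ U₂ →
      Sub Γ (STy.arrow Q₁ S₁ Q₂ S₂) (STy.arrow R₁ U₁ R₂ U₂)
  | all {n m k : ℕ} {Γ : Env n m k} {U₁ U₂ : STy n m} {Q₁ Q₂ : Qual n} {S₁ S₂ : STy n (m + 1)} :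
      Sub Γ U₂ U₁ → SubQual (Γ.type U₂) Q₁ Q₂ → Sub (Γ.type U₂) S₁ S₂ →
      Sub Γ (STy.all U₁ Q₁ S₁) (STy.all U₂ Q₂ S₂)
  | qall {n m k : ℕ} {Γ : Env n m k} {B₁ B₂ : Qual n} {Q₁ Q₂ : Qual (n + 1)}
      {S₁ S₂ : STy (n + 1) m} :
      SubQual Γ B₂ B₁ → SubQual (Γ.qual B₂) Q₁ Q₂ → Sub (Γ.qual B₂) S₁ S₂ →
      Sub Γ (STy.qall B₁ Q₁ S₁) (STy.qall B₂ Q₂ S₂)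

/-- Subtyping of qualified types: `Γ ⊢ {Q₁} S₁ <: {Q₂} S₂` iff `Γ ⊢ Q₁ <: Q₂` and `Γ ⊢ S₁ <: S₂`. -/
def QSub {n m k : ℕ} (Γ : Env n m k) (T₁ T₂ : QTy n m) : Prop :=
  SubQual Γ T₁.q T₂.q ∧ Sub Γ T₁.s T₂.s

/-! ### Typing -/

/-- Typing `Γ | R ⊢ t : T`, where `R` is the colour context. -/
inductive HasTy : {n m k : ℕ} → Env n m k → Qual n → Tm n m k → QTy n m → Prop
  | var {n m k : ℕ} {Γ : Env n m k} {R : Qual n} (x : Fin k) :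
      HasTy Γ R (Tm.var x) (Γ.typeOf x)
  | abs {n m k : ℕ} {Γ : Env n m k} {R P Q₁ Q₂ : Qual n} {S₁ S₂ : STy n m}
      {t : Tm n m (k + 1)} :
      HasTy (Γ.term ⟨Q₁, S₁⟩) P t ⟨Q₂, S₂⟩ →
      HasTy Γ R (Tm.lam P t) ⟨P, STy.arrow Q₁ S₁ Q₂ S₂⟩
  | tabs {n m k : ℕ} {Γ : Env n m k} {R P Q : Qual n} {U : STy n m} {S : STy n (m + 1)}
      {t : Tm n (m + 1) k} :
      HasTy (Γ.type U) P t ⟨Q, S⟩ →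
      HasTy Γ R (Tm.tlam P U t) ⟨P, STy.all U Q S⟩
  | qabs {n m k : ℕ} {Γ : Env n m k} {R P B : Qual n} {Q : Qual (n + 1)} {S : STy (n + 1) m}
      {t : Tm (n + 1) m k} :
      HasTy (Γ.qual B) P.shift t ⟨Q, S⟩ →
      HasTy Γ R (Tm.qlam P B t) ⟨P, STy.qall B Q S⟩
  | app {n m k : ℕ} {Γ : Env n m k} {R Q₁ Q₂ : Qual n} {S₁ S₂ : STy n m} {s t : Tm n m k} :
      HasTy Γ R s ⟨R, STy.arrow Q₁ S₁ Q₂ S₂⟩ → HasTy Γ R t ⟨Q₁, S₁⟩ →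
      HasTy Γ R (Tm.app s t) ⟨Q₂, S₂⟩
  | tapp {n m k : ℕ} {Γ : Env n m k} {R Q : Qual n} {U U' : STy n m} {S : STy n (m + 1)}
      {s : Tm n m k} :
      HasTy Γ R s ⟨R, STy.all U Q S⟩ → Sub Γ U' U →
      HasTy Γ R (Tm.tapp s U') ⟨Q, S.instT U'⟩
  | qapp {n m k : ℕ} {Γ : Env n m k} {R B B' : Qual n} {Q : Qual (n + 1)} {S : STy (n + 1) m}
      {s : Tm n m k} :
      HasTy Γ R s ⟨R, STy.qall B Q S⟩ → SubQual Γ B' B →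
      HasTy Γ R (Tm.qapp s B') ⟨Q.subst (Qual.single B'), S.instQ B'⟩
  | assertQ {n m k : ℕ} {Γ : Env n m k} {R Q : Qual n} {S : STy n m} {s : Tm n m k} :
      HasTy Γ R s ⟨Q, S⟩ → HasTy Γ R (Tm.assertQ Q s) ⟨Q, S⟩
  | upqual {n m k : ℕ} {Γ : Env n m k} {R Q Q' : Qual n} {S : STy n m} {s : Tm n m k} :
      HasTy Γ R s ⟨Q, S⟩ → SubQual Γ Q Q' → HasTy Γ R (Tm.upqual Q' s) ⟨Q', S⟩
  | sub {n m k : ℕ} {Γ : Env n m k} {R : Qual n} {T₁ T₂ : QTy n m} {t : Tm n m k} :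
      HasTy Γ R t T₁ → QSub Γ T₁ T₂ → HasTy Γ R t T₂
  | subEff {n m k : ℕ} {Γ : Env n m k} {R₁ R₂ : Qual n} {T : QTy n m} {t : Tm n m k} :
      HasTy Γ R₁ t T → SubQual Γ R₁ R₂ → HasTy Γ R₂ t T

/-! ### The CK machine -/

/-- Stack frames. -/
inductive Frame : Type
  /-- `□(t)`: the function is being evaluated. -/
  | arg (t : Tm 0 0 0)
  /-- `v(□)`: the argument is being evaluated. -/
  | fn (v : Tm 0 0 0)
  /-- `□[S]` -/
  | targ (S : STy 0 0)
  /-- `□{Q}` -/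
  | qarg (Q : Qual 0)
  /-- `assert Q □` -/
  | assertQ (Q : Qual 0)
  /-- `upqual Q □` -/
  | upqual (Q : Qual 0)
  /-- The body of a called function of colour `C` is being evaluated. -/
  | barrier (C : Colour)

/-- Continuations: stacks of frames, the innermost frame first. -/
abbrev Cont : Type := List Frame

/-- Machine configurations `⟨c, κ⟩`. -/
structure Config : Type where
  c : Tm 0 0 0
  κ : Cont

/-- A function of colour `C` may be called on top of `κ`: its colour is below that of every barrier
on the stack, i.e. an asynchronous function needs a stack without synchronous barriers. -/
def Compatible (C : Colour) (κ : Cont) : Prop :=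
  ∀ D : Colour, Frame.barrier D ∈ κ → Colour.Le C D

/-- Machine steps. -/
inductive Step : Config → Config → Prop
  | pushArg (s t : Tm 0 0 0) (κ : Cont) :
      Step ⟨Tm.app s t, κ⟩ ⟨s, Frame.arg t :: κ⟩
  | pushTArg (s : Tm 0 0 0) (S : STy 0 0) (κ : Cont) :
      Step ⟨Tm.tapp s S, κ⟩ ⟨s, Frame.targ S :: κ⟩
  | pushQArg (s : Tm 0 0 0) (Q : Qual 0) (κ : Cont) :
      Step ⟨Tm.qapp s Q, κ⟩ ⟨s, Frame.qarg Q :: κ⟩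
  | pushAssert (Q : Qual 0) (s : Tm 0 0 0) (κ : Cont) :
      Step ⟨Tm.assertQ Q s, κ⟩ ⟨s, Frame.assertQ Q :: κ⟩
  | pushUpqual (Q : Qual 0) (s : Tm 0 0 0) (κ : Cont) :
      Step ⟨Tm.upqual Q s, κ⟩ ⟨s, Frame.upqual Q :: κ⟩
  | evalArg {v : Tm 0 0 0} (t : Tm 0 0 0) (κ : Cont) : v.IsValue →
      Step ⟨v, Frame.arg t :: κ⟩ ⟨t, Frame.fn v :: κ⟩
  | app {v : Tm 0 0 0} {P : Qual 0} {t : Tm 0 0 1} {C : Colour} {κ : Cont} :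
      v.IsValue → P.eval = some C → Compatible C κ →
      Step ⟨v, Frame.fn (Tm.lam P t) :: κ⟩ ⟨t.inst v, Frame.barrier C :: κ⟩
  | tapp {P : Qual 0} {U S : STy 0 0} {t : Tm 0 1 0} {C : Colour} {κ : Cont} :
      P.eval = some C → Compatible C κ →
      Step ⟨Tm.tlam P U t, Frame.targ S :: κ⟩ ⟨t.instT S, Frame.barrier C :: κ⟩
  | qapp {P B Q : Qual 0} {t : Tm 1 0 0} {C : Colour} {κ : Cont} :
      P.eval = some C → Compatible C κ →
      Step ⟨Tm.qlam P B t, Frame.qarg Q :: κ⟩ ⟨t.instQ Q, Frame.barrier C :: κ⟩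
  | assertQ {v : Tm 0 0 0} {P Q : Qual 0} {C D : Colour} {κ : Cont} :
      v.tag = some P → P.eval = some C → Q.eval = some D → Colour.Le C D →
      Step ⟨v, Frame.assertQ Q :: κ⟩ ⟨v, κ⟩
  | upqual {v : Tm 0 0 0} {P Q : Qual 0} {C D : Colour} {κ : Cont} :
      v.tag = some P → P.eval = some C → Q.eval = some D → Colour.Le C D →
      Step ⟨v, Frame.upqual Q :: κ⟩ ⟨v.retag Q, κ⟩
  | popBarrier {v : Tm 0 0 0} (C : Colour) (κ : Cont) : v.IsValue →
      Step ⟨v, Frame.barrier C :: κ⟩ ⟨v, κ⟩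

/-! ### Well-typed configurations -/

/-- `ContTy R T κ A`: the continuation `κ` takes the result, of type `T`, of a computation in
colour context `R` to a final answer of type `A`. -/
inductive ContTy : Qual 0 → QTy 0 0 → Cont → QTy 0 0 → Prop
  | nil (R : Qual 0) (T : QTy 0 0) : ContTy R T [] T
  | arg {R Q₁ Q₂ : Qual 0} {S₁ S₂ : STy 0 0} {t : Tm 0 0 0} {κ : Cont} {A : QTy 0 0} :
      HasTy Env.empty R t ⟨Q₁, S₁⟩ → ContTy R ⟨Q₂, S₂⟩ κ A →
      ContTy R ⟨R, STy.arrow Q₁ S₁ Q₂ S₂⟩ (Frame.arg t :: κ) A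
  | fn {R Q₁ Q₂ : Qual 0} {S₁ S₂ : STy 0 0} {v : Tm 0 0 0} {κ : Cont} {A : QTy 0 0} :
      v.IsValue → HasTy Env.empty R v ⟨R, STy.arrow Q₁ S₁ Q₂ S₂⟩ → ContTy R ⟨Q₂, S₂⟩ κ A →
      ContTy R ⟨Q₁, S₁⟩ (Frame.fn v :: κ) A
  | targ {R Q : Qual 0} {U U' : STy 0 0} {S : STy 0 1} {κ : Cont} {A : QTy 0 0} :
      Sub Env.empty U' U → ContTy R ⟨Q, S.instT U'⟩ κ A →
      ContTy R ⟨R, STy.all U Q S⟩ (Frame.targ U' :: κ) A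
  | qarg {R B B' : Qual 0} {Q : Qual 1} {S : STy 1 0} {κ : Cont} {A : QTy 0 0} :
      SubQual Env.empty B' B → ContTy R ⟨Q.subst (Qual.single B'), S.instQ B'⟩ κ A →
      ContTy R ⟨R, STy.qall B Q S⟩ (Frame.qarg B' :: κ) A
  | assertQ {R Q : Qual 0} {S : STy 0 0} {κ : Cont} {A : QTy 0 0} :
      ContTy R ⟨Q, S⟩ κ A → ContTy R ⟨Q, S⟩ (Frame.assertQ Q :: κ) A
  | upqual {R Q Q' : Qual 0} {S : STy 0 0} {κ : Cont} {A : QTy 0 0} :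
      SubQual Env.empty Q Q' → ContTy R ⟨Q', S⟩ κ A →
      ContTy R ⟨Q, S⟩ (Frame.upqual Q' :: κ) A
  | barrier {C : Colour} {R : Qual 0} {T : QTy 0 0} {κ : Cont} {A : QTy 0 0} :
      SubQual Env.empty C.toQual R → ContTy R T κ A →
      ContTy C.toQual T (Frame.barrier C :: κ) A
  | sub {R : Qual 0} {T₁ T₂ : QTy 0 0} {κ : Cont} {A : QTy 0 0} :
      QSub Env.empty T₁ T₂ → ContTy R T₂ κ A → ContTy R T₁ κ A

/-- A configuration is well typed with answer type `A` if, in the empty environment and for some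
colour context `R` and type `T`, its control has type `T` in context `R` and its continuation
accepts such a computation. -/
def Config.HasAnswer (γ : Config) (A : QTy 0 0) : Prop :=
  ∃ (R : Qual 0) (T : QTy 0 0), HasTy Env.empty R γ.c T ∧ ContTy R T γ.κ A

def Config.WellTyped (γ : Config) : Prop := ∃ A : QTy 0 0, γ.HasAnswer A

/-- `γ.Calls P κ`: in `γ`, a function value with tag `P` (a term, type or qualifier abstraction)
is about to be called on top of the stack `κ`. The call need not be allowed by `Step`. -/
inductive Config.Calls : Config → Qual 0 → Cont → Prop
  | app {v : Tm 0 0 0} (P : Qual 0) (t : Tm 0 0 1) (κ : Cont) : v.IsValue →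
      Calls ⟨v, Frame.fn (Tm.lam P t) :: κ⟩ P κ
  | tapp (P : Qual 0) (U S : STy 0 0) (t : Tm 0 1 0) (κ : Cont) :
      Calls ⟨Tm.tlam P U t, Frame.targ S :: κ⟩ P κ
  | qapp (P B Q : Qual 0) (t : Tm 1 0 0) (κ : Cont) :
      Calls ⟨Tm.qlam P B t, Frame.qarg Q :: κ⟩ P κ

end FsubA

/-!
The type of a called function forces its tag `P` below the colour context `R` of the call, and `R`
lies below every barrier of a continuation typed in `R`. Hence the body, typed in context `P`, can
run behind a barrier of colour `eval P`, whereas an asynchronous call beneath a synchronous barrier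
would give `async <: sync`. Values have the same types in every colour context, which lets them be
substituted into bodies of another colour and returned through barriers.

Subqualification is transitive because every rule that acts on the left-hand qualifier commutes with
the cut. Subtyping is more delicate: transitivity at a quantifier needs narrowing, narrowing a type
bound needs transitivity through the old bound, and the circle is broken by an induction on the size
of the middle type.
-/

namespace FsubA

/-! ### Renaming and substitution -/

variable {n n' n'' m m' m'' k k' : ℕ}

theorem liftRen_id : liftRen (id : Fin n → Fin n) = id := by
  funext i; cases i using Fin.cases <;> rfl

theorem liftRen_comp (ρ' : Fin n' → Fin n'') (ρ : Fin n → Fin n') :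
    liftRen ρ' ∘ liftRen ρ = liftRen (ρ' ∘ ρ) := by
  funext i; cases i using Fin.cases <;> rfl

theorem liftRen_comp_succ (ρ : Fin n → Fin n') : liftRen ρ ∘ Fin.succ = Fin.succ ∘ ρ := rfl

namespace Qual

theorem rename_id (Q : Qual n) : Q.rename id = Q := by
  induction Q <;> simp_all [rename]

theorem subst_var (Q : Qual n) : Q.subst var = Q := by
  induction Q <;> simp_all [subst]

theorem rename_rename (ρ : Fin n → Fin n') (ρ' : Fin n' → Fin n'') (Q : Qual n) :
    (Q.rename ρ).rename ρ' = Q.rename (ρ' ∘ ρ) := by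
  induction Q <;> simp_all [rename]

theorem subst_rename (ρ : Fin n → Fin n') (σ : Fin n' → Qual n'') (Q : Qual n) :
    (Q.rename ρ).subst σ = Q.subst (σ ∘ ρ) := by
  induction Q <;> simp_all [rename, subst]

theorem rename_subst (σ : Fin n → Qual n') (ρ : Fin n' → Fin n'') (Q : Qual n) :
    (Q.subst σ).rename ρ = Q.subst (fun Y => (σ Y).rename ρ) := by
  induction Q <;> simp_all [rename, subst]

theorem subst_subst (σ : Fin n → Qual n') (σ' : Fin n' → Qual n'') (Q : Qual n) :
    (Q.subst σ).subst σ' = Q.subst (fun Y => (σ Y).subst σ') := by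
  induction Q <;> simp_all [subst]

theorem rename_eq_subst (ρ : Fin n → Fin n') (Q : Qual n) :
    Q.rename ρ = Q.subst (fun Y => var (ρ Y)) := by
  rw [← (Q.rename ρ).subst_var, subst_rename]; rfl

theorem shift_rename (ρ : Fin n → Fin n') (Q : Qual n) :
    Q.shift.rename (liftRen ρ) = (Q.rename ρ).shift := by
  simp only [shift, rename_rename, liftRen_comp_succ]

theorem shift_subst (σ : Fin n → Qual n') (Q : Qual n) :
    Q.shift.subst (liftSub σ) = (Q.subst σ).shift := by
  simp only [shift, subst_rename, rename_subst]; rfl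

theorem shift_subst_single (Q B : Qual n) : Q.shift.subst (single B) = Q := by
  rw [shift, subst_rename]; exact subst_var Q

theorem liftSub_var : liftSub (var : Fin n → Qual n) = var := by
  funext Y; cases Y using Fin.cases <;> rfl

theorem liftSub_comp_liftRen (σ : Fin n' → Qual n'') (ρ : Fin n → Fin n') :
    liftSub σ ∘ liftRen ρ = liftSub (σ ∘ ρ) := by
  funext Y; cases Y using Fin.cases <;> rfl

theorem liftSub_rename (σ : Fin n → Qual n') (ρ : Fin n' → Fin n'') :
    (fun Y => (liftSub σ Y).rename (liftRen ρ)) = liftSub (fun Y => (σ Y).rename ρ) := by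
  funext Y
  cases Y using Fin.cases with
  | zero => rfl
  | succ Y => exact shift_rename ρ (σ Y)

theorem liftSub_subst (σ : Fin n → Qual n') (σ' : Fin n' → Qual n'') :
    (fun Y => (liftSub σ Y).subst (liftSub σ')) = liftSub (fun Y => (σ Y).subst σ') := by
  funext Y
  cases Y using Fin.cases with
  | zero => rfl
  | succ Y => exact shift_subst σ' (σ Y)

theorem single_rename (B : Qual n) (ρ : Fin n → Fin n') :
    (fun Y => (single B Y).rename ρ) = single (B.rename ρ) ∘ liftRen ρ := by
  funext Y; cases Y using Fin.cases <;> rfl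

theorem single_subst (B : Qual n) (σ : Fin n → Qual n') :
    (fun Y => (single B Y).subst σ) = fun Y => (liftSub σ Y).subst (single (B.subst σ)) := by
  funext Y
  cases Y using Fin.cases with
  | zero => rfl
  | succ Y => exact (shift_subst_single (σ Y) _).symm

theorem subst_single_rename (ρ : Fin n → Fin n') (Q : Qual (n + 1)) (B : Qual n) :
    (Q.subst (single B)).rename ρ = (Q.rename (liftRen ρ)).subst (single (B.rename ρ)) := by
  rw [rename_subst, subst_rename, single_rename]

theorem subst_single_subst (σ : Fin n → Qual n') (Q : Qual (n + 1)) (B : Qual n) :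
    (Q.subst (single B)).subst σ = (Q.subst (liftSub σ)).subst (single (B.subst σ)) := by
  rw [subst_subst, subst_subst, single_subst]

end Qual

namespace STy

theorem rename_id (S : STy n m) : S.rename id id = S := by
  induction S <;> simp_all [rename, Qual.rename_id, liftRen_id]

theorem liftSub_var : liftSub (var : Fin m → STy n m) = var := by
  funext X; cases X using Fin.cases <;> rfl

theorem shiftQ_var (X : Fin m) : (var X : STy n m).shiftQ = var X := rfl

theorem subst_var (S : STy n m) : S.subst Qual.var var = S := by
  induction S <;>
    simp_all [subst, Qual.subst_var, liftSub_var, Qual.liftSub_var, shiftQ_var]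

theorem rename_rename (ρ : Fin n → Fin n') (ξ : Fin m → Fin m') (ρ' : Fin n' → Fin n'')
    (ξ' : Fin m' → Fin m'') (S : STy n m) :
    (S.rename ρ ξ).rename ρ' ξ' = S.rename (ρ' ∘ ρ) (ξ' ∘ ξ) := by
  induction S generalizing n' m' n'' m'' <;>
    simp_all [rename, Qual.rename_rename, liftRen_comp]

theorem shiftT_rename (ρ : Fin n → Fin n') (ξ : Fin m → Fin m') (S : STy n m) :
    S.shiftT.rename ρ (liftRen ξ) = (S.rename ρ ξ).shiftT := by
  simp only [shiftT, rename_rename, liftRen_comp_succ]; rfl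

theorem shiftQ_rename (ρ : Fin n → Fin n') (ξ : Fin m → Fin m') (S : STy n m) :
    S.shiftQ.rename (liftRen ρ) ξ = (S.rename ρ ξ).shiftQ := by
  simp only [shiftQ, rename_rename, liftRen_comp_succ]; rfl

theorem liftSub_comp_liftRen (τ : Fin m' → STy n m'') (ξ : Fin m → Fin m') :
    liftSub τ ∘ liftRen ξ = liftSub (τ ∘ ξ) := by
  funext X; cases X using Fin.cases <;> rfl

theorem subst_rename (ρ : Fin n → Fin n') (ξ : Fin m → Fin m') (σ : Fin n' → Qual n'')
    (τ : Fin m' → STy n'' m'') (S : STy n m) :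
    (S.rename ρ ξ).subst σ τ = S.subst (σ ∘ ρ) (τ ∘ ξ) := by
  induction S generalizing n' m' n'' m'' with
  | qall B Q S ih =>
    simp only [rename, subst, Qual.subst_rename, Qual.liftSub_comp_liftRen, ih]; rfl
  | _ => simp_all [rename, subst, Qual.subst_rename, liftSub_comp_liftRen]

theorem liftSub_rename (τ : Fin m → STy n m') (ρ : Fin n → Fin n') (ξ : Fin m' → Fin m'') :
    (fun X => (liftSub τ X).rename ρ (liftRen ξ)) = liftSub (fun X => (τ X).rename ρ ξ) := by
  funext X
  cases X using Fin.cases with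
  | zero => rfl
  | succ X => exact shiftT_rename ρ ξ (τ X)

theorem rename_subst (σ : Fin n → Qual n') (τ : Fin m → STy n' m') (ρ : Fin n' → Fin n'')
    (ξ : Fin m' → Fin m'') (S : STy n m) :
    (S.subst σ τ).rename ρ ξ =
      S.subst (fun Y => (σ Y).rename ρ) (fun X => (τ X).rename ρ ξ) := by
  induction S generalizing n' m' n'' m'' <;>
    simp_all [rename, subst, Qual.rename_subst, liftSub_rename, Qual.liftSub_rename, shiftQ_rename]

theorem shiftT_subst (σ : Fin n → Qual n') (τ : Fin m → STy n' m') (S : STy n m) :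
    S.shiftT.subst σ (liftSub τ) = (S.subst σ τ).shiftT := by
  simp only [shiftT, subst_rename, rename_subst, Qual.rename_id]; rfl

theorem shiftQ_subst (σ : Fin n → Qual n') (τ : Fin m → STy n' m') (S : STy n m) :
    S.shiftQ.subst (Qual.liftSub σ) (fun X => (τ X).shiftQ) = (S.subst σ τ).shiftQ := by
  simp only [shiftQ, subst_rename, rename_subst]; rfl

theorem liftSub_subst (τ : Fin m → STy n m') (σ : Fin n → Qual n') (τ' : Fin m' → STy n' m'') :
    (fun X => (liftSub τ X).subst σ (liftSub τ')) = liftSub (fun X => (τ X).subst σ τ') := by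
  funext X
  cases X using Fin.cases with
  | zero => rfl
  | succ X => exact shiftT_subst σ τ' (τ X)

theorem subst_subst (σ : Fin n → Qual n') (τ : Fin m → STy n' m') (σ' : Fin n' → Qual n'')
    (τ' : Fin m' → STy n'' m'') (S : STy n m) :
    (S.subst σ τ).subst σ' τ' =
      S.subst (fun Y => (σ Y).subst σ') (fun X => (τ X).subst σ' τ') := by
  induction S generalizing n' m' n'' m'' <;>
    simp_all [subst, Qual.subst_subst, liftSub_subst, Qual.liftSub_subst, shiftQ_subst]

theorem shiftT_subst_single (S U : STy n m) : S.shiftT.subst Qual.var (single U) = S := by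
  rw [shiftT, subst_rename]; exact subst_var S

theorem shiftQ_subst_single (S : STy n m) (B : Qual n) :
    S.shiftQ.subst (Qual.single B) var = S := by
  rw [shiftQ, subst_rename]; exact subst_var S

theorem single_rename (U : STy n m) (ρ : Fin n → Fin n') (ξ : Fin m → Fin m') :
    (fun X => (single U X).rename ρ ξ) = single (U.rename ρ ξ) ∘ liftRen ξ := by
  funext X; cases X using Fin.cases <;> rfl

theorem single_subst (U : STy n m) (σ : Fin n → Qual n') (τ : Fin m → STy n' m') :
    (fun X => (single U X).subst σ τ) =
      fun X => (liftSub τ X).subst Qual.var (single (U.subst σ τ)) := by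
  funext X
  cases X using Fin.cases with
  | zero => rfl
  | succ X => exact (shiftT_subst_single (τ X) _).symm

theorem instT_rename (ρ : Fin n → Fin n') (ξ : Fin m → Fin m') (S : STy n (m + 1))
    (U : STy n m) : (S.instT U).rename ρ ξ = (S.rename ρ (liftRen ξ)).instT (U.rename ρ ξ) := by
  rw [instT, instT, rename_subst, subst_rename, single_rename]; rfl

theorem instQ_rename (ρ : Fin n → Fin n') (ξ : Fin m → Fin m') (S : STy (n + 1) m)
    (B : Qual n) : (S.instQ B).rename ρ ξ = (S.rename (liftRen ρ) ξ).instQ (B.rename ρ) := by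
  rw [instQ, instQ, rename_subst, subst_rename, Qual.single_rename]; rfl

theorem instT_subst (σ : Fin n → Qual n') (τ : Fin m → STy n' m') (S : STy n (m + 1))
    (U : STy n m) : (S.instT U).subst σ τ = (S.subst σ (liftSub τ)).instT (U.subst σ τ) := by
  simp only [instT, subst_subst, single_subst, Qual.subst_var]; rfl

theorem instQ_subst (σ : Fin n → Qual n') (τ : Fin m → STy n' m') (S : STy (n + 1) m)
    (B : Qual n) :
    (S.instQ B).subst σ τ =
      (S.subst (Qual.liftSub σ) (fun X => (τ X).shiftQ)).instQ (B.subst σ) := by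
  simp only [instQ, subst_subst, Qual.single_subst, shiftQ_subst_single]; rfl

end STy

namespace QTy

/-- Simultaneous renaming of the qualifier and type variables of a qualified type. -/
def rename (ρ : Fin n → Fin n') (ξ : Fin m → Fin m') (T : QTy n m) : QTy n' m' :=
  ⟨T.q.rename ρ, T.s.rename ρ ξ⟩

/-- Simultaneous substitution in a qualified type, as in `STy.subst`. -/
def subst (σ : Fin n → Qual n') (τ : Fin m → STy n' m') (T : QTy n m) : QTy n' m' :=
  ⟨T.q.subst σ, T.s.subst σ τ⟩

theorem rename_id (T : QTy n m) : T.rename id id = T := by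
  simp only [rename, Qual.rename_id, STy.rename_id]

theorem subst_var (T : QTy n m) : T.subst Qual.var STy.var = T := by
  simp only [subst, Qual.subst_var, STy.subst_var]

theorem shiftT_eq_rename (T : QTy n m) : T.shiftT = T.rename id Fin.succ := by
  simp only [rename, shiftT, STy.shiftT, Qual.rename_id]

theorem shiftT_rename (ρ : Fin n → Fin n') (ξ : Fin m → Fin m') (T : QTy n m) :
    T.shiftT.rename ρ (liftRen ξ) = (T.rename ρ ξ).shiftT := by
  simp only [rename, shiftT, STy.shiftT_rename]

theorem shiftQ_rename (ρ : Fin n → Fin n') (ξ : Fin m → Fin m') (T : QTy n m) :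
    T.shiftQ.rename (liftRen ρ) ξ = (T.rename ρ ξ).shiftQ := by
  simp only [rename, shiftQ, STy.shiftQ_rename, Qual.shift_rename]

theorem shiftT_subst (σ : Fin n → Qual n') (τ : Fin m → STy n' m') (T : QTy n m) :
    T.shiftT.subst σ (STy.liftSub τ) = (T.subst σ τ).shiftT := by
  simp only [subst, shiftT, STy.shiftT_subst]

theorem shiftQ_subst (σ : Fin n → Qual n') (τ : Fin m → STy n' m') (T : QTy n m) :
    T.shiftQ.subst (Qual.liftSub σ) (fun X => (τ X).shiftQ) = (T.subst σ τ).shiftQ := by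
  simp only [subst, shiftQ, STy.shiftQ_subst, Qual.shift_subst]

theorem shiftT_subst_single (T : QTy n m) (U : STy n m) :
    T.shiftT.subst Qual.var (STy.single U) = T := by
  simp only [subst, shiftT, STy.shiftT_subst_single, Qual.subst_var]

theorem shiftQ_subst_single (T : QTy n m) (B : Qual n) :
    T.shiftQ.subst (Qual.single B) STy.var = T := by
  simp only [subst, shiftQ, STy.shiftQ_subst_single, Qual.shift_subst_single]

end QTy

/-! ### Subqualification -/

variable {Γ : Env n m k} {Δ : Env n' m' k'}

namespace SubQual

theorem refl (Γ : Env n m k) (Q : Qual n) : SubQual Γ Q Q := by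
  induction Q with
  | var Y => exact .reflVar Y
  | sync => exact .bot _
  | async => exact .top _
  | meet Q R hQ hR => exact .meetIntro (.meetElim₁ hQ) (.meetElim₂ hR)
  | join Q R hQ hR => exact .joinElim (.joinIntro₁ hQ) (.joinIntro₂ hR)

/-- Subqualifications whose last rule analyses the right-hand qualifier (or is reflexivity of a
variable). These are the only ones that matter for cuts: see `trans_of_byRight`. -/
inductive ByRight (Γ : Env n m k) : Qual n → Qual n → Prop
  | top (Q : Qual n) : ByRight Γ Q Qual.async
  | reflVar (Y : Fin n) : ByRight Γ (Qual.var Y) (Qual.var Y)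
  | meetIntro {Q R₁ R₂ : Qual n} :
      SubQual Γ Q R₁ → SubQual Γ Q R₂ → ByRight Γ Q (Qual.meet R₁ R₂)
  | joinIntro₁ {Q R₁ R₂ : Qual n} : SubQual Γ Q R₁ → ByRight Γ Q (Qual.join R₁ R₂)
  | joinIntro₂ {Q R₁ R₂ : Qual n} : SubQual Γ Q R₂ → ByRight Γ Q (Qual.join R₁ R₂)

-- The other rules only change the left-hand qualifier, so they commute with the cut.
theorem trans_of_byRight {P Q R : Qual n} (h : SubQual Γ P Q)
    (hR : ∀ P', ByRight Γ P' Q → SubQual Γ P' R) : SubQual Γ P R := by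
  induction h with
  | top P => exact hR P (.top P)
  | bot => exact .bot R
  | reflVar Y => exact hR _ (.reflVar Y)
  | var _ ih => exact .var (ih hR)
  | meetElim₁ _ ih => exact .meetElim₁ (ih hR)
  | meetElim₂ _ ih => exact .meetElim₂ (ih hR)
  | meetIntro h₁ h₂ => exact hR _ (.meetIntro h₁ h₂)
  | joinIntro₁ h => exact hR _ (.joinIntro₁ h)
  | joinIntro₂ h => exact hR _ (.joinIntro₂ h)
  | joinElim _ _ ih₁ ih₂ => exact .joinElim (ih₁ hR) (ih₂ hR)

theorem trans {P Q R : Qual n} (h : SubQual Γ P Q) (h' : SubQual Γ Q R) : SubQual Γ P R := by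
  induction h' generalizing P with
  | top => exact .top P
  | bot => exact h.trans_of_byRight fun _ => nofun
  | reflVar => exact h
  | var hR => exact h.trans_of_byRight fun | _, .reflVar _ => .var hR
  | meetElim₁ _ ih => exact h.trans_of_byRight fun | _, .meetIntro h₁ _ => ih h₁
  | meetElim₂ _ ih => exact h.trans_of_byRight fun | _, .meetIntro _ h₂ => ih h₂
  | meetIntro _ _ ih₁ ih₂ => exact .meetIntro (ih₁ h) (ih₂ h)
  | joinIntro₁ _ ih => exact .joinIntro₁ (ih h)
  | joinIntro₂ _ ih => exact .joinIntro₂ (ih h)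
  | joinElim _ _ ih₁ ih₂ =>
    exact h.trans_of_byRight fun
      | _, .joinIntro₁ h₁ => ih₁ h₁
      | _, .joinIntro₂ h₂ => ih₂ h₂

theorem subst {σ : Fin n → Qual n'} {Q R : Qual n} (h : SubQual Γ Q R)
    (hσ : ∀ Y, SubQual Δ (σ Y) ((Γ.qbound Y).subst σ)) : SubQual Δ (Q.subst σ) (R.subst σ) := by
  induction h with
  | top => exact .top _
  | bot => exact .bot _
  | reflVar => exact refl _ _
  | var _ ih => exact (hσ _).trans ih
  | meetElim₁ _ ih => exact .meetElim₁ ih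
  | meetElim₂ _ ih => exact .meetElim₂ ih
  | meetIntro _ _ ih₁ ih₂ => exact .meetIntro ih₁ ih₂
  | joinIntro₁ _ ih => exact .joinIntro₁ ih
  | joinIntro₂ _ ih => exact .joinIntro₂ ih
  | joinElim _ _ ih₁ ih₂ => exact .joinElim ih₁ ih₂

theorem rename {ρ : Fin n → Fin n'} {Q R : Qual n} (h : SubQual Γ Q R)
    (hρ : ∀ Y, Δ.qbound (ρ Y) = (Γ.qbound Y).rename ρ) :
    SubQual Δ (Q.rename ρ) (R.rename ρ) := by
  simp only [Qual.rename_eq_subst] at hρ ⊢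
  exact h.subst fun Y => .var (hρ Y ▸ refl _ _)

theorem shift {Q R : Qual n} (h : SubQual Γ Q R) (B : Qual n) :
    SubQual (Γ.qual B) Q.shift R.shift :=
  h.rename fun _ => rfl

theorem congr_qbound {Δ : Env n m' k'} {Q R : Qual n} (h : SubQual Γ Q R)
    (hΔ : Δ.qbound = Γ.qbound) : SubQual Δ Q R := by
  simpa only [Qual.rename_id] using
    h.rename (Δ := Δ) (ρ := id) fun Y => by rw [hΔ, Qual.rename_id, id]

theorem var_qbound (Γ : Env n m k) (Y : Fin n) : SubQual Γ (Qual.var Y) (Γ.qbound Y) :=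
  .var (refl _ _)

end SubQual

/-! ### Evaluation of qualifiers -/

theorem Qual.eval_meet_eq_some {Q R : Qual n} {C : Colour} :
    (meet Q R).eval = some C ↔
      ∃ C₁, Q.eval = some C₁ ∧ ∃ C₂, R.eval = some C₂ ∧ C₁.meet C₂ = C := by
  simp [eval, Option.bind_eq_some_iff]

theorem Qual.eval_join_eq_some {Q R : Qual n} {C : Colour} :
    (join Q R).eval = some C ↔
      ∃ C₁, Q.eval = some C₁ ∧ ∃ C₂, R.eval = some C₂ ∧ C₁.join C₂ = C := by
  simp [eval, Option.bind_eq_some_iff]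

namespace SubQual

theorem meet_toQual (Γ : Env n m k) (C D : Colour) :
    SubQual Γ (Qual.meet C.toQual D.toQual) (C.meet D).toQual ∧
      SubQual Γ (C.meet D).toQual (Qual.meet C.toQual D.toQual) := by
  cases C
  · exact ⟨.meetElim₁ (refl _ _), .bot _⟩
  · exact ⟨.meetElim₂ (refl _ _), .meetIntro (.top _) (refl _ _)⟩

theorem join_toQual (Γ : Env n m k) (C D : Colour) :
    SubQual Γ (Qual.join C.toQual D.toQual) (C.join D).toQual ∧
      SubQual Γ (C.join D).toQual (Qual.join C.toQual D.toQual) := by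
  cases C
  · exact ⟨.joinElim (.bot _) (refl _ _), .joinIntro₂ (refl _ _)⟩
  · exact ⟨.top _, .joinIntro₁ (refl _ _)⟩

theorem meet_mono {Q Q' R R' : Qual n} (hQ : SubQual Γ Q Q') (hR : SubQual Γ R R') :
    SubQual Γ (Qual.meet Q R) (Qual.meet Q' R') :=
  .meetIntro (.meetElim₁ hQ) (.meetElim₂ hR)

theorem join_mono {Q Q' R R' : Qual n} (hQ : SubQual Γ Q Q') (hR : SubQual Γ R R') :
    SubQual Γ (Qual.join Q R) (Qual.join Q' R') :=
  .joinElim (.joinIntro₁ hQ) (.joinIntro₂ hR)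

theorem toQual_of_eval (Γ : Env n m k) {Q : Qual n} {C : Colour} (h : Q.eval = some C) :
    SubQual Γ Q C.toQual ∧ SubQual Γ C.toQual Q := by
  induction Q generalizing C with
  | var => cases h
  | sync => cases h; exact ⟨refl _ _, refl _ _⟩
  | async => cases h; exact ⟨refl _ _, refl _ _⟩
  | meet Q R ihQ ihR =>
    obtain ⟨C₁, hQ, C₂, hR, rfl⟩ := Qual.eval_meet_eq_some.1 h
    exact ⟨(meet_mono (ihQ hQ).1 (ihR hR).1).trans (meet_toQual Γ C₁ C₂).1,
      (meet_toQual Γ C₁ C₂).2.trans (meet_mono (ihQ hQ).2 (ihR hR).2)⟩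
  | join Q R ihQ ihR =>
    obtain ⟨C₁, hQ, C₂, hR, rfl⟩ := Qual.eval_join_eq_some.1 h
    exact ⟨(join_mono (ihQ hQ).1 (ihR hR).1).trans (join_toQual Γ C₁ C₂).1,
      (join_toQual Γ C₁ C₂).2.trans (join_mono (ihQ hQ).2 (ihR hR).2)⟩

theorem colourLe_of_toQual {C D : Colour} (h : SubQual Γ C.toQual D.toQual) : Colour.Le C D := by
  cases C with
  | sync => exact .sync_le D
  | async =>
    cases D with
    | sync => cases h
    | async => exact .le_async _

end SubQual

/-! ### Environment renamings -/

namespace Env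

/-- Renamings of qualifier and type variables that carry the bounds of `Γ` to those of `Δ`. -/
structure BoundRen (Γ : Env n m k) (Δ : Env n' m' k') (ρ : Fin n → Fin n')
    (ξ : Fin m → Fin m') : Prop where
  qbound : ∀ Y, Δ.qbound (ρ Y) = (Γ.qbound Y).rename ρ
  tbound : ∀ X, Δ.tbound (ξ X) = (Γ.tbound X).rename ρ ξ

/-- Renamings of all three kinds of variables that carry the environment `Γ` to `Δ`. -/
structure Ren (Γ : Env n m k) (Δ : Env n' m' k') (ρ : Fin n → Fin n') (ξ : Fin m → Fin m')
    (ζ : Fin k → Fin k') : Prop extends BoundRen Γ Δ ρ ξ where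
  typeOf : ∀ x, Δ.typeOf (ζ x) = (Γ.typeOf x).rename ρ ξ

variable {ρ : Fin n → Fin n'} {ξ : Fin m → Fin m'} {ζ : Fin k → Fin k'}

theorem BoundRen.type (h : BoundRen Γ Δ ρ ξ) (U : STy n m) :
    BoundRen (Γ.type U) (Δ.type (U.rename ρ ξ)) ρ (liftRen ξ) where
  qbound := h.qbound
  tbound X := by
    cases X using Fin.cases with
    | zero => exact (STy.shiftT_rename ρ ξ U).symm
    | succ X => exact (congrArg STy.shiftT (h.tbound X)).trans (STy.shiftT_rename ρ ξ _).symm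

theorem BoundRen.qual (h : BoundRen Γ Δ ρ ξ) (B : Qual n) :
    BoundRen (Γ.qual B) (Δ.qual (B.rename ρ)) (liftRen ρ) ξ where
  qbound Y := by
    cases Y using Fin.cases with
    | zero => exact (Qual.shift_rename ρ B).symm
    | succ Y => exact (congrArg Qual.shift (h.qbound Y)).trans (Qual.shift_rename ρ _).symm
  tbound X := (congrArg STy.shiftQ (h.tbound X)).trans (STy.shiftQ_rename ρ ξ _).symm

namespace Ren

theorem term (h : Ren Γ Δ ρ ξ ζ) (T : QTy n m) :
    Ren (Γ.term T) (Δ.term (T.rename ρ ξ)) ρ ξ (liftRen ζ) where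
  qbound := h.qbound
  tbound := h.tbound
  typeOf x := by
    cases x using Fin.cases with
    | zero => rfl
    | succ x => exact h.typeOf x

theorem type (h : Ren Γ Δ ρ ξ ζ) (U : STy n m) :
    Ren (Γ.type U) (Δ.type (U.rename ρ ξ)) ρ (liftRen ξ) ζ where
  toBoundRen := h.toBoundRen.type U
  typeOf x := (congrArg QTy.shiftT (h.typeOf x)).trans (QTy.shiftT_rename ρ ξ _).symm

theorem qual (h : Ren Γ Δ ρ ξ ζ) (B : Qual n) :
    Ren (Γ.qual B) (Δ.qual (B.rename ρ)) (liftRen ρ) ξ ζ where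
  toBoundRen := h.toBoundRen.qual B
  typeOf x := (congrArg QTy.shiftQ (h.typeOf x)).trans (QTy.shiftQ_rename ρ ξ _).symm

theorem succ_term (Γ : Env n m k) (T : QTy n m) : Ren Γ (Γ.term T) id id Fin.succ where
  qbound _ := (Qual.rename_id _).symm
  tbound _ := (STy.rename_id _).symm
  typeOf _ := (QTy.rename_id _).symm

theorem succ_type (Γ : Env n m k) (U : STy n m) : Ren Γ (Γ.type U) id Fin.succ id where
  qbound _ := (Qual.rename_id _).symm
  tbound _ := rfl
  typeOf _ := QTy.shiftT_eq_rename _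

theorem succ_qual (Γ : Env n m k) (B : Qual n) : Ren Γ (Γ.qual B) Fin.succ id id where
  qbound _ := rfl
  tbound _ := rfl
  typeOf _ := rfl

end Ren

end Env

/-! ### Subtyping -/

namespace Sub

theorem refl (Γ : Env n m k) (S : STy n m) : Sub Γ S S := by
  induction S generalizing k with
  | top => exact .top _
  | var X => exact .reflVar X
  | arrow Q₁ S₁ Q₂ S₂ ih₁ ih₂ => exact .arrow (.refl _ _) (ih₁ _) (.refl _ _) (ih₂ _)
  | all U Q S ihU ihS => exact .all (ihU _) (.refl _ _) (ihS _)
  | qall B Q S ihS => exact .qall (.refl _ _) (.refl _ _) (ihS _)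

theorem var_tbound (Γ : Env n m k) (X : Fin m) : Sub Γ (STy.var X) (Γ.tbound X) :=
  .var (refl _ _)

theorem rename {ρ : Fin n → Fin n'} {ξ : Fin m → Fin m'} {S U : STy n m} (h : Sub Γ S U)
    (hρ : Γ.BoundRen Δ ρ ξ) : Sub Δ (S.rename ρ ξ) (U.rename ρ ξ) := by
  induction h generalizing n' m' k' with
  | top => exact .top _
  | reflVar => exact .reflVar _
  | var _ ih => exact .var (hρ.tbound _ ▸ ih hρ)
  | arrow h₁ _ h₂ _ ih₁ ih₂ =>
    exact .arrow (h₁.rename hρ.qbound) (ih₁ hρ) (h₂.rename hρ.qbound) (ih₂ hρ)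
  | all _ hQ _ ihU ihS =>
    exact .all (ihU hρ) (hQ.rename (hρ.type _).qbound) (ihS (hρ.type _))
  | qall hB hQ _ ihS =>
    exact .qall (hB.rename hρ.qbound) (hQ.rename (hρ.qual _).qbound) (ihS (hρ.qual _))

theorem shiftTerm {S U : STy n m} (h : Sub Γ S U) (T : QTy n m) : Sub (Γ.term T) S U := by
  simpa only [STy.rename_id] using h.rename (Env.Ren.succ_term Γ T).toBoundRen

theorem shiftT {S U : STy n m} (h : Sub Γ S U) (V : STy n m) :
    Sub (Γ.type V) S.shiftT U.shiftT :=
  h.rename (Env.Ren.succ_type Γ V).toBoundRen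

theorem shiftQ {S U : STy n m} (h : Sub Γ S U) (B : Qual n) :
    Sub (Γ.qual B) S.shiftQ U.shiftQ :=
  h.rename (Env.Ren.succ_qual Γ B).toBoundRen

end Sub

/-- Size of a simple type, the measure for transitivity of subtyping. Qualifiers do not count, since
`SubQual.trans` holds outright. -/
def STy.size {n m : ℕ} : STy n m → ℕ
  | top => 0
  | var _ => 0
  | arrow _ S₁ _ S₂ => S₁.size + S₂.size + 1
  | all U _ S => U.size + S.size + 1
  | qall _ _ S => S.size + 1

theorem STy.size_rename (ρ : Fin n → Fin n') (ξ : Fin m → Fin m') (S : STy n m) :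
    (S.rename ρ ξ).size = S.size := by
  induction S generalizing n' m' <;> simp_all [rename, size]

/-- `Γ.Narrows Δ N`: `Δ` arises from `Γ` by narrowing bounds, and every type bound that changes has
size less than `N` in `Γ`. -/
structure Env.Narrows (Γ Δ : Env n m k) (N : ℕ) : Prop where
  qbound : ∀ Y, SubQual Δ (Qual.var Y) (Γ.qbound Y)
  tbound : ∀ X, Δ.tbound X = Γ.tbound X ∨
    (Γ.tbound X).size < N ∧ Sub Δ (Δ.tbound X) (Γ.tbound X)

namespace Env.Narrows

variable {N : ℕ} {Δ : Env n m k}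

theorem subQual (h : Narrows Γ Δ N) {Q R : Qual n} (hQ : SubQual Γ Q R) : SubQual Δ Q R := by
  simpa only [Qual.subst_var] using
    hQ.subst (Δ := Δ) (σ := Qual.var) fun Y => (Qual.subst_var _).symm ▸ h.qbound Y

theorem type (h : Narrows Γ Δ N) (U : STy n m) : Narrows (Γ.type U) (Δ.type U) N where
  qbound Y := (h.qbound Y).congr_qbound (Δ := Δ.type _) rfl
  tbound X := by
    cases X using Fin.cases with
    | zero => exact .inl rfl
    | succ X =>
      exact (h.tbound X).imp (congrArg STy.shiftT) fun ⟨hN, hX⟩ =>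
        ⟨(STy.size_rename _ _ _).trans_lt hN, hX.shiftT U⟩

theorem qual (h : Narrows Γ Δ N) (B : Qual n) : Narrows (Γ.qual B) (Δ.qual B) N where
  qbound Y := by
    cases Y using Fin.cases with
    | zero => exact .var_qbound (Δ.qual B) 0
    | succ Y => exact (h.qbound Y).shift B
  tbound X := (h.tbound X).imp (congrArg STy.shiftQ) fun ⟨hN, hX⟩ =>
    ⟨(STy.size_rename _ _ _).trans_lt hN, hX.shiftQ B⟩

theorem of_type_bound (Γ : Env n m k) {U U' : STy n m} (hN : U.size < N) (h : Sub Γ U' U) :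
    Narrows (Γ.type U) (Γ.type U') N where
  qbound := .var_qbound (Γ.type U')
  tbound X := by
    cases X using Fin.cases with
    | zero => exact .inr ⟨(STy.size_rename _ _ _).trans_lt hN, h.shiftT U'⟩
    | succ X => exact .inl rfl

theorem of_qual_bound (Γ : Env n m k) {B B' : Qual n} (h : SubQual Γ B' B) :
    Narrows (Γ.qual B) (Γ.qual B') N where
  qbound Y := by
    cases Y using Fin.cases with
    | zero => exact .var (h.shift B')
    | succ Y => exact .var_qbound (Γ.qual B') Y.succ
  tbound _ := .inl rfl

end Env.Narrows

namespace Sub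

/-- Transitivity of subtyping, in every scope, through middle types of size less than `N`: the
induction hypothesis on which both narrowing and transitivity rest. -/
def TransBelow (N : ℕ) : Prop :=
  ∀ {n m k : ℕ} {Γ : Env n m k} {S U V : STy n m},
    U.size < N → Sub Γ S U → Sub Γ U V → Sub Γ S V

theorem narrow {N : ℕ} {Δ : Env n m k} {S U : STy n m} (hN : TransBelow N) (h : Sub Γ S U)
    (hΔ : Γ.Narrows Δ N) : Sub Δ S U := by
  induction h with
  | top => exact .top _
  | reflVar => exact .reflVar _
  | var _ ih =>
    rcases hΔ.tbound _ with hX | ⟨hlt, hX⟩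
    · exact .var (hX ▸ ih hΔ)
    · exact .var (hN hlt hX (ih hΔ))
  | arrow h₁ _ h₂ _ ih₁ ih₂ => exact .arrow (hΔ.subQual h₁) (ih₁ hΔ) (hΔ.subQual h₂) (ih₂ hΔ)
  | all _ hQ _ ihU ihS => exact .all (ihU hΔ) ((hΔ.type _).subQual hQ) (ihS (hΔ.type _))
  | qall hB hQ _ ihS =>
    exact .qall (hΔ.subQual hB) ((hΔ.qual _).subQual hQ) (ihS (hΔ.qual _))

theorem trans_of_transBelow {S U V : STy n m} (hU : TransBelow U.size) (h : Sub Γ S U)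
    (h' : Sub Γ U V) : Sub Γ S V := by
  induction h with
  | top => cases h'; exact .top _
  | reflVar => exact h'
  | var _ ih => exact .var (ih hU h')
  | arrow hQ₁ hS₁ hQ₂ hS₂ =>
    cases h' with
    | top => exact .top _
    | arrow hR₁ hU₁ hR₂ hU₂ =>
      exact .arrow (hR₁.trans hQ₁) (hU (by simp only [STy.size]; omega) hU₁ hS₁)
        (hQ₂.trans hR₂) (hU (by simp only [STy.size]; omega) hS₂ hU₂)
  | @all _ _ _ Γ _ U _ Q _ S hV hQ hS =>
    cases h' with
    | top => exact .top _
    | all hV' hQ' hS' =>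
      have hlt : U.size < (STy.all U Q S).size := by simp only [STy.size]; omega
      have hn := Env.Narrows.of_type_bound Γ hlt hV'
      exact .all (hU hlt hV' hV) ((hn.subQual hQ).trans hQ')
        (hU (by simp only [STy.size]; omega) (narrow hU hS hn) hS')
  | @qall _ _ _ Γ _ B _ Q _ S hB hQ hS =>
    cases h' with
    | top => exact .top _
    | qall hB' hQ' hS' =>
      have hn := Env.Narrows.of_qual_bound Γ (N := (STy.qall B Q S).size) hB'
      exact .qall (hB'.trans hB) ((hn.subQual hQ).trans hQ')
        (hU (by simp only [STy.size]; omega) (narrow hU hS hn) hS')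

theorem transBelow (N : ℕ) : TransBelow N := by
  induction N with
  | zero => exact fun h => absurd h (Nat.not_lt_zero _)
  | succ N ih =>
    exact fun hlt => trans_of_transBelow fun h => ih (h.trans_le (Nat.lt_succ_iff.1 hlt))

theorem trans {S U V : STy n m} (h : Sub Γ S U) (h' : Sub Γ U V) : Sub Γ S V :=
  trans_of_transBelow (transBelow _) h h'

end Sub

/-- Substitutions of qualifiers and simple types for the variables of `Γ` that respect the bounds:
the images are typed in the scope of `Δ`. -/
structure Env.BoundSub (Γ : Env n m k) (Δ : Env n' m' k') (σ : Fin n → Qual n')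
    (τ : Fin m → STy n' m') : Prop where
  qbound : ∀ Y, SubQual Δ (σ Y) ((Γ.qbound Y).subst σ)
  tbound : ∀ X, Sub Δ (τ X) ((Γ.tbound X).subst σ τ)

namespace Env.BoundSub

variable {σ : Fin n → Qual n'} {τ : Fin m → STy n' m'}

theorem type (h : BoundSub Γ Δ σ τ) (U : STy n m) :
    BoundSub (Γ.type U) (Δ.type (U.subst σ τ)) σ (STy.liftSub τ) where
  qbound Y := (h.qbound Y).congr_qbound (Δ := Δ.type _) rfl
  tbound X := by
    cases X using Fin.cases with
    | zero => exact STy.shiftT_subst σ τ U ▸ .var_tbound (Δ.type (U.subst σ τ)) 0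
    | succ X => exact STy.shiftT_subst σ τ (Γ.tbound X) ▸ (h.tbound X).shiftT _

theorem qual (h : BoundSub Γ Δ σ τ) (B : Qual n) :
    BoundSub (Γ.qual B) (Δ.qual (B.subst σ)) (Qual.liftSub σ) (fun X => (τ X).shiftQ) where
  qbound Y := by
    cases Y using Fin.cases with
    | zero => exact Qual.shift_subst σ B ▸ .var_qbound (Δ.qual (B.subst σ)) 0
    | succ Y => exact Qual.shift_subst σ (Γ.qbound Y) ▸ (h.qbound Y).shift _
  tbound X := STy.shiftQ_subst σ τ (Γ.tbound X) ▸ (h.tbound X).shiftQ _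

theorem id (Γ : Env n m k) : BoundSub Γ Γ Qual.var STy.var where
  qbound Y := (Qual.subst_var _).symm ▸ .var_qbound Γ Y
  tbound X := (STy.subst_var _).symm ▸ .var_tbound Γ X

theorem single_type {U U' : STy n m} (h : Sub Γ U' U) :
    BoundSub (Γ.type U) Γ Qual.var (STy.single U') where
  qbound := (BoundSub.id Γ).qbound
  tbound X := by
    cases X using Fin.cases with
    | zero => exact (STy.shiftT_subst_single U U').symm ▸ h
    | succ X => exact (STy.shiftT_subst_single (Γ.tbound X) U').symm ▸ .var_tbound Γ X

theorem single_qual {B B' : Qual n} (h : SubQual Γ B' B) :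
    BoundSub (Γ.qual B) Γ (Qual.single B') STy.var where
  qbound Y := by
    cases Y using Fin.cases with
    | zero => exact (Qual.shift_subst_single B B').symm ▸ h
    | succ Y => exact (Qual.shift_subst_single (Γ.qbound Y) B').symm ▸ .var_qbound Γ Y
  tbound X := (STy.shiftQ_subst_single (Γ.tbound X) B').symm ▸ .var_tbound Γ X

end Env.BoundSub

theorem Sub.subst {σ : Fin n → Qual n'} {τ : Fin m → STy n' m'} {S U : STy n m}
    (h : Sub Γ S U) (hσ : Γ.BoundSub Δ σ τ) : Sub Δ (S.subst σ τ) (U.subst σ τ) := by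
  induction h generalizing n' m' k' with
  | top => exact .top _
  | reflVar => exact .refl _ _
  | var _ ih => exact (hσ.tbound _).trans (ih hσ)
  | arrow h₁ _ h₂ _ ih₁ ih₂ =>
    exact .arrow (h₁.subst hσ.qbound) (ih₁ hσ) (h₂.subst hσ.qbound) (ih₂ hσ)
  | all _ hQ _ ihU ihS =>
    exact .all (ihU hσ) (hQ.subst (hσ.type _).qbound) (ihS (hσ.type _))
  | qall hB hQ _ ihS =>
    exact .qall (hB.subst hσ.qbound) (hQ.subst (hσ.qual _).qbound) (ihS (hσ.qual _))

namespace QSub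

theorem refl (Γ : Env n m k) (T : QTy n m) : QSub Γ T T :=
  ⟨.refl _ _, .refl _ _⟩

theorem trans {T₁ T₂ T₃ : QTy n m} (h : QSub Γ T₁ T₂) (h' : QSub Γ T₂ T₃) : QSub Γ T₁ T₃ :=
  ⟨h.1.trans h'.1, h.2.trans h'.2⟩

theorem rename {ρ : Fin n → Fin n'} {ξ : Fin m → Fin m'} {T T' : QTy n m} (h : QSub Γ T T')
    (hρ : Γ.BoundRen Δ ρ ξ) : QSub Δ (T.rename ρ ξ) (T'.rename ρ ξ) :=
  ⟨h.1.rename hρ.qbound, h.2.rename hρ⟩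

theorem subst {σ : Fin n → Qual n'} {τ : Fin m → STy n' m'} {T T' : QTy n m} (h : QSub Γ T T')
    (hσ : Γ.BoundSub Δ σ τ) : QSub Δ (T.subst σ τ) (T'.subst σ τ) :=
  ⟨h.1.subst hσ.qbound, h.2.subst hσ⟩

end QSub

/-! ### Substitution in typing derivations -/

namespace HasTy

theorem rename {ρ : Fin n → Fin n'} {ξ : Fin m → Fin m'} {ζ : Fin k → Fin k'} {R : Qual n}
    {t : Tm n m k} {T : QTy n m} (h : HasTy Γ R t T) (hρ : Γ.Ren Δ ρ ξ ζ) :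
    HasTy Δ (R.rename ρ) (t.rename ρ ξ ζ) (T.rename ρ ξ) := by
  induction h generalizing n' m' k' with
  | var x => rw [← hρ.typeOf]; exact .var _
  | abs _ ih => exact .abs (ih (hρ.term _))
  | tabs _ ih => exact .tabs (ih (hρ.type _))
  | qabs _ ih => exact .qabs (Qual.shift_rename ρ _ ▸ ih (hρ.qual _))
  | app _ _ ihs iht => exact .app (ihs hρ) (iht hρ)
  | tapp _ hU ih =>
    simp only [QTy.rename, STy.instT_rename]
    exact .tapp (ih hρ) (hU.rename hρ.toBoundRen)
  | qapp _ hB ih =>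
    simp only [QTy.rename, STy.instQ_rename, Qual.subst_single_rename]
    exact .qapp (ih hρ) (hB.rename hρ.qbound)
  | assertQ _ ih => exact .assertQ (ih hρ)
  | upqual _ hQ ih => exact .upqual (ih hρ) (hQ.rename hρ.qbound)
  | sub _ hT ih => exact .sub (ih hρ) (hT.rename hρ.toBoundRen)
  | subEff _ hR ih => exact .subEff (ih hρ) (hR.rename hρ.qbound)

theorem shiftTerm {R : Qual n} {t : Tm n m k} {T : QTy n m} (h : HasTy Γ R t T)
    (T' : QTy n m) : HasTy (Γ.term T') R (t.rename id id Fin.succ) T := by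
  simpa only [Qual.rename_id, QTy.rename_id] using h.rename (.succ_term Γ T')

theorem shiftT {R : Qual n} {t : Tm n m k} {T : QTy n m} (h : HasTy Γ R t T) (U : STy n m) :
    HasTy (Γ.type U) R (t.rename id Fin.succ id) T.shiftT := by
  simpa only [Qual.rename_id, QTy.shiftT_eq_rename] using h.rename (.succ_type Γ U)

theorem shiftQ {R : Qual n} {t : Tm n m k} {T : QTy n m} (h : HasTy Γ R t T) (B : Qual n) :
    HasTy (Γ.qual B) R.shift (t.rename Fin.succ id id) T.shiftQ :=
  h.rename (.succ_qual Γ B)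

end HasTy

/-- Substitutions for all variables of `Γ` that respect bounds and types. As variables are typed in
every colour context, so must be the terms that replace them; equivalently, they are typed in the
least context `sync`. -/
structure Env.Subst (Γ : Env n m k) (Δ : Env n' m' k') (σ : Fin n → Qual n')
    (τ : Fin m → STy n' m') (υ : Fin k → Tm n' m' k') : Prop extends BoundSub Γ Δ σ τ where
  typeOf : ∀ x, HasTy Δ Qual.sync (υ x) ((Γ.typeOf x).subst σ τ)

namespace Env.Subst

section Lifting

variable {σ : Fin n → Qual n'} {τ : Fin m → STy n' m'} {υ : Fin k → Tm n' m' k'}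

theorem term (h : Subst Γ Δ σ τ υ) (T : QTy n m) :
    Subst (Γ.term T) (Δ.term (T.subst σ τ)) σ τ (Tm.liftSub υ) where
  qbound Y := (h.qbound Y).congr_qbound (Δ := Δ.term _) rfl
  tbound X := (h.tbound X).shiftTerm _
  typeOf x := by
    cases x using Fin.cases with
    | zero => exact .var 0
    | succ x => exact (h.typeOf x).shiftTerm _

theorem type (h : Subst Γ Δ σ τ υ) (U : STy n m) :
    Subst (Γ.type U) (Δ.type (U.subst σ τ)) σ (STy.liftSub τ)
      (fun x => (υ x).rename id Fin.succ id) where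
  toBoundSub := h.toBoundSub.type U
  typeOf x := QTy.shiftT_subst σ τ (Γ.typeOf x) ▸ (h.typeOf x).shiftT _

theorem qual (h : Subst Γ Δ σ τ υ) (B : Qual n) :
    Subst (Γ.qual B) (Δ.qual (B.subst σ)) (Qual.liftSub σ) (fun X => (τ X).shiftQ)
      (fun x => (υ x).rename Fin.succ id id) where
  toBoundSub := h.toBoundSub.qual B
  typeOf x := QTy.shiftQ_subst σ τ (Γ.typeOf x) ▸ (h.typeOf x).shiftQ _

end Lifting

theorem single_term {v : Tm n m k} {T : QTy n m} (h : HasTy Γ Qual.sync v T) :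
    Subst (Γ.term T) Γ Qual.var STy.var (Fin.cases v Tm.var) where
  qbound := (BoundSub.id Γ).qbound
  tbound := (BoundSub.id Γ).tbound
  typeOf x := by
    rw [QTy.subst_var]
    cases x using Fin.cases with
    | zero => exact h
    | succ x => exact .var x

theorem single_type {U U' : STy n m} (h : Sub Γ U' U) :
    Subst (Γ.type U) Γ Qual.var (STy.single U') Tm.var where
  toBoundSub := .single_type h
  typeOf x := (QTy.shiftT_subst_single (Γ.typeOf x) U').symm ▸ .var x

theorem single_qual {B B' : Qual n} (h : SubQual Γ B' B) :
    Subst (Γ.qual B) Γ (Qual.single B') STy.var Tm.var where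
  toBoundSub := .single_qual h
  typeOf x := (QTy.shiftQ_subst_single (Γ.typeOf x) B').symm ▸ .var x

end Env.Subst

namespace HasTy

theorem subst {σ : Fin n → Qual n'} {τ : Fin m → STy n' m'} {υ : Fin k → Tm n' m' k'}
    {R : Qual n} {t : Tm n m k} {T : QTy n m} (h : HasTy Γ R t T) (hσ : Γ.Subst Δ σ τ υ) :
    HasTy Δ (R.subst σ) (t.subst σ τ υ) (T.subst σ τ) := by
  induction h generalizing n' m' k' with
  | var x => exact .subEff (hσ.typeOf x) (.bot _)
  | abs _ ih => exact .abs (ih (hσ.term _))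
  | tabs _ ih => exact .tabs (ih (hσ.type _))
  | qabs _ ih => exact .qabs (Qual.shift_subst σ _ ▸ ih (hσ.qual _))
  | app _ _ ihs iht => exact .app (ihs hσ) (iht hσ)
  | tapp _ hU ih =>
    simp only [QTy.subst, STy.instT_subst]
    exact .tapp (ih hσ) (hU.subst hσ.toBoundSub)
  | qapp _ hB ih =>
    simp only [QTy.subst, STy.instQ_subst, Qual.subst_single_subst]
    exact .qapp (ih hσ) (hB.subst hσ.qbound)
  | assertQ _ ih => exact .assertQ (ih hσ)
  | upqual _ hQ ih => exact .upqual (ih hσ) (hQ.subst hσ.qbound)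
  | sub _ hT ih => exact .sub (ih hσ) (hT.subst hσ.toBoundSub)
  | subEff _ hR ih => exact .subEff (ih hσ) (hR.subst hσ.qbound)

/-! ### Inversion of typing -/

/-- Typings whose last rule is not a subsumption, hence determined by the head of the term. Every
typing reduces to one of these: see `exists_structural`. -/
inductive Structural {n m k : ℕ} (Γ : Env n m k) (R : Qual n) : Tm n m k → QTy n m → Prop
  | var (x : Fin k) : Structural Γ R (Tm.var x) (Γ.typeOf x)
  | abs {P Q₁ Q₂ : Qual n} {S₁ S₂ : STy n m} {t : Tm n m (k + 1)} :
      HasTy (Γ.term ⟨Q₁, S₁⟩) P t ⟨Q₂, S₂⟩ →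
      Structural Γ R (Tm.lam P t) ⟨P, STy.arrow Q₁ S₁ Q₂ S₂⟩
  | tabs {P Q : Qual n} {U : STy n m} {S : STy n (m + 1)} {t : Tm n (m + 1) k} :
      HasTy (Γ.type U) P t ⟨Q, S⟩ → Structural Γ R (Tm.tlam P U t) ⟨P, STy.all U Q S⟩
  | qabs {P B : Qual n} {Q : Qual (n + 1)} {S : STy (n + 1) m} {t : Tm (n + 1) m k} :
      HasTy (Γ.qual B) P.shift t ⟨Q, S⟩ → Structural Γ R (Tm.qlam P B t) ⟨P, STy.qall B Q S⟩
  | app {Q₁ Q₂ : Qual n} {S₁ S₂ : STy n m} {s t : Tm n m k} :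
      HasTy Γ R s ⟨R, STy.arrow Q₁ S₁ Q₂ S₂⟩ → HasTy Γ R t ⟨Q₁, S₁⟩ →
      Structural Γ R (Tm.app s t) ⟨Q₂, S₂⟩
  | tapp {Q : Qual n} {U U' : STy n m} {S : STy n (m + 1)} {s : Tm n m k} :
      HasTy Γ R s ⟨R, STy.all U Q S⟩ → Sub Γ U' U →
      Structural Γ R (Tm.tapp s U') ⟨Q, S.instT U'⟩
  | qapp {B B' : Qual n} {Q : Qual (n + 1)} {S : STy (n + 1) m} {s : Tm n m k} :
      HasTy Γ R s ⟨R, STy.qall B Q S⟩ → SubQual Γ B' B →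
      Structural Γ R (Tm.qapp s B') ⟨Q.subst (Qual.single B'), S.instQ B'⟩
  | assertQ {Q : Qual n} {S : STy n m} {s : Tm n m k} :
      HasTy Γ R s ⟨Q, S⟩ → Structural Γ R (Tm.assertQ Q s) ⟨Q, S⟩
  | upqual {Q Q' : Qual n} {S : STy n m} {s : Tm n m k} :
      HasTy Γ R s ⟨Q, S⟩ → SubQual Γ Q Q' → Structural Γ R (Tm.upqual Q' s) ⟨Q', S⟩

variable {R : Qual n} {T : QTy n m}

theorem Structural.subEff {R' : Qual n} {t : Tm n m k} (h : Structural Γ R t T)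
    (hR : SubQual Γ R R') : Structural Γ R' t T := by
  cases h with
  | var x => exact .var x
  | abs ht => exact .abs ht
  | tabs ht => exact .tabs ht
  | qabs ht => exact .qabs ht
  | app hs ht => exact .app (.subEff (.sub hs ⟨hR, .refl _ _⟩) hR) (.subEff ht hR)
  | tapp hs hU => exact .tapp (.subEff (.sub hs ⟨hR, .refl _ _⟩) hR) hU
  | qapp hs hB => exact .qapp (.subEff (.sub hs ⟨hR, .refl _ _⟩) hR) hB
  | assertQ hs => exact .assertQ (.subEff hs hR)
  | upqual hs hQ => exact .upqual (.subEff hs hR) hQ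

theorem exists_structural {t : Tm n m k} (h : HasTy Γ R t T) :
    ∃ T', Structural Γ R t T' ∧ QSub Γ T' T := by
  induction h with
  | var x => exact ⟨_, .var x, .refl _ _⟩
  | abs ht => exact ⟨_, .abs ht, .refl _ _⟩
  | tabs ht => exact ⟨_, .tabs ht, .refl _ _⟩
  | qabs ht => exact ⟨_, .qabs ht, .refl _ _⟩
  | app hs ht => exact ⟨_, .app hs ht, .refl _ _⟩
  | tapp hs hU => exact ⟨_, .tapp hs hU, .refl _ _⟩
  | qapp hs hB => exact ⟨_, .qapp hs hB, .refl _ _⟩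
  | assertQ hs => exact ⟨_, .assertQ hs, .refl _ _⟩
  | upqual hs hQ => exact ⟨_, .upqual hs hQ, .refl _ _⟩
  | sub _ hT ih => exact ih.imp fun _ ⟨h, hT'⟩ => ⟨h, hT'.trans hT⟩
  | subEff _ hR ih => exact ih.imp fun _ ⟨h, hT'⟩ => ⟨h.subEff hR, hT'⟩

/-! ### Values and calls -/

theorem of_isValue {v : Tm n m k} (h : HasTy Γ R v T) (hv : v.IsValue) (R' : Qual n) :
    HasTy Γ R' v T := by
  obtain ⟨_, h, hT⟩ := h.exists_structural
  refine .sub ?_ hT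
  cases hv with
  | lam => cases h with | abs ht => exact .abs ht
  | tlam => cases h with | tabs ht => exact .tabs ht
  | qlam => cases h with | qabs ht => exact .qabs ht

theorem tag_subQual {v : Tm n m k} {P : Qual n} (h : HasTy Γ R v T) (hv : v.tag = some P) :
    SubQual Γ P T.q := by
  obtain ⟨_, h, hT⟩ := h.exists_structural
  cases h <;> cases hv <;> exact hT.1

theorem retag {v : Tm n m k} {P Q Q' : Qual n} {S : STy n m} (h : HasTy Γ R v ⟨Q, S⟩)
    (hv : v.tag = some P) (hQ : SubQual Γ Q Q') : HasTy Γ R (v.retag Q') ⟨Q', S⟩ := by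
  have hP : SubQual Γ P Q' := (h.tag_subQual hv).trans hQ
  obtain ⟨T, h, -, hS⟩ := h.exists_structural
  refine .sub (T₁ := ⟨Q', T.s⟩) ?_ ⟨.refl _ _, hS⟩
  cases h with
  | abs ht => cases hv; exact .abs (ht.subEff (hP.congr_qbound (Δ := Γ.term _) rfl))
  | tabs ht => cases hv; exact .tabs (ht.subEff (hP.congr_qbound (Δ := Γ.type _) rfl))
  | qabs ht => cases hv; exact .qabs (ht.subEff (hP.shift _))
  | _ => cases hv

theorem beta {P Q Q₁ Q₂ R' : Qual n} {S₁ S₂ : STy n m} {t : Tm n m (k + 1)} {v : Tm n m k}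
    (h : HasTy Γ R (Tm.lam P t) ⟨Q, STy.arrow Q₁ S₁ Q₂ S₂⟩) (hv : v.IsValue)
    (hvT : HasTy Γ R' v ⟨Q₁, S₁⟩) : HasTy Γ P (t.inst v) ⟨Q₂, S₂⟩ := by
  have ⟨_, .abs ht, _, .arrow hQ₁ hS₁ hQ₂ hS₂⟩ := h.exists_structural
  have hvT' := (hvT.of_isValue hv Qual.sync).sub (T₂ := ⟨_, _⟩) ⟨hQ₁, hS₁⟩
  have hbody := ht.subst (.single_term hvT')
  rw [Qual.subst_var, QTy.subst_var] at hbody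
  exact hbody.sub ⟨hQ₂, hS₂⟩

theorem tbeta {P Q Q' : Qual n} {U U' V : STy n m} {S : STy n (m + 1)} {t : Tm n (m + 1) k}
    (h : HasTy Γ R (Tm.tlam P V t) ⟨Q, STy.all U Q' S⟩) (hU' : Sub Γ U' U) :
    HasTy Γ P (t.instT U') ⟨Q', S.instT U'⟩ := by
  have ⟨_, .tabs ht, _, .all hU hQ hS⟩ := h.exists_structural
  have hT := QSub.subst (T := ⟨_, _⟩) (T' := ⟨_, _⟩) ⟨hQ, hS⟩ (.single_type hU')
  have hbody := (ht.subst (.single_type (hU'.trans hU))).sub hT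
  rwa [QTy.subst, Qual.subst_var, Qual.subst_var] at hbody

theorem qbeta {P Q B B' C : Qual n} {Q' : Qual (n + 1)} {S : STy (n + 1) m}
    {t : Tm (n + 1) m k} (h : HasTy Γ R (Tm.qlam P C t) ⟨Q, STy.qall B Q' S⟩)
    (hB' : SubQual Γ B' B) :
    HasTy Γ P (t.instQ B') ⟨Q'.subst (Qual.single B'), S.instQ B'⟩ := by
  have ⟨_, .qabs ht, _, .qall hB hQ hS⟩ := h.exists_structural
  have hT := QSub.subst (T := ⟨_, _⟩) (T' := ⟨_, _⟩) ⟨hQ, hS⟩ (.single_qual hB')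
  have hbody := (ht.subst (.single_qual (hB'.trans hB))).sub hT
  rwa [Qual.shift_subst_single] at hbody

end HasTy

/-! ### Continuations -/

/-- `FrameTy R T F R' T'`: the single frame `F` takes a result of type `T` computed in colour
context `R` to one of type `T'` in colour context `R'`. A continuation is typed by composing
frames, up to subsumption: see `ContTy.uncons`. -/
inductive FrameTy : Qual 0 → QTy 0 0 → Frame → Qual 0 → QTy 0 0 → Prop
  | arg {R Q₁ Q₂ : Qual 0} {S₁ S₂ : STy 0 0} {t : Tm 0 0 0} :
      HasTy Env.empty R t ⟨Q₁, S₁⟩ →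
      FrameTy R ⟨R, STy.arrow Q₁ S₁ Q₂ S₂⟩ (Frame.arg t) R ⟨Q₂, S₂⟩
  | fn {R Q₁ Q₂ : Qual 0} {S₁ S₂ : STy 0 0} {v : Tm 0 0 0} :
      HasTy Env.empty R v ⟨R, STy.arrow Q₁ S₁ Q₂ S₂⟩ →
      FrameTy R ⟨Q₁, S₁⟩ (Frame.fn v) R ⟨Q₂, S₂⟩
  | targ {R Q : Qual 0} {U U' : STy 0 0} {S : STy 0 1} :
      Sub Env.empty U' U → FrameTy R ⟨R, STy.all U Q S⟩ (Frame.targ U') R ⟨Q, S.instT U'⟩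
  | qarg {R B B' : Qual 0} {Q : Qual 1} {S : STy 1 0} :
      SubQual Env.empty B' B →
      FrameTy R ⟨R, STy.qall B Q S⟩ (Frame.qarg B') R ⟨Q.subst (Qual.single B'), S.instQ B'⟩
  | assertQ {R Q : Qual 0} {S : STy 0 0} : FrameTy R ⟨Q, S⟩ (Frame.assertQ Q) R ⟨Q, S⟩
  | upqual {R Q Q' : Qual 0} {S : STy 0 0} :
      SubQual Env.empty Q Q' → FrameTy R ⟨Q, S⟩ (Frame.upqual Q') R ⟨Q', S⟩
  | barrier {C : Colour} {R : Qual 0} {T : QTy 0 0} :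
      SubQual Env.empty C.toQual R → FrameTy C.toQual T (Frame.barrier C) R T

theorem FrameTy.subQual {R R' : Qual 0} {T T' : QTy 0 0} {F : Frame}
    (h : FrameTy R T F R' T') : SubQual Env.empty R R' := by
  cases h with
  | barrier hR => exact hR
  | _ => exact .refl _ _

namespace ContTy

variable {R : Qual 0} {T A : QTy 0 0} {κ : Cont}

theorem uncons {F : Frame} (h : ContTy R T (F :: κ) A) :
    ∃ T₀ R' T', QSub Env.empty T T₀ ∧ FrameTy R T₀ F R' T' ∧ ContTy R' T' κ A := by
  generalize hκ' : F :: κ = κ' at h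
  induction h with
  | nil => cases hκ'
  | arg ht hκ => cases hκ'; exact ⟨_, _, _, .refl _ _, .arg ht, hκ⟩
  | fn _ hv hκ => cases hκ'; exact ⟨_, _, _, .refl _ _, .fn hv, hκ⟩
  | targ hU hκ => cases hκ'; exact ⟨_, _, _, .refl _ _, .targ hU, hκ⟩
  | qarg hB hκ => cases hκ'; exact ⟨_, _, _, .refl _ _, .qarg hB, hκ⟩
  | assertQ hκ => cases hκ'; exact ⟨_, _, _, .refl _ _, .assertQ, hκ⟩
  | upqual hQ hκ => cases hκ'; exact ⟨_, _, _, .refl _ _, .upqual hQ, hκ⟩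
  | barrier hR hκ => cases hκ'; exact ⟨_, _, _, .refl _ _, .barrier hR, hκ⟩
  | sub hT _ ih =>
    obtain ⟨T₀, R', T', hT', hF⟩ := ih hκ'
    exact ⟨T₀, R', T', hT.trans hT', hF⟩

theorem subQual_of_barrier_mem {D : Colour} (h : ContTy R T κ A) (hD : Frame.barrier D ∈ κ) :
    SubQual Env.empty R D.toQual := by
  induction κ generalizing R T with
  | nil => cases hD
  | cons F κ ih =>
    obtain ⟨_, _, _, -, hF, hκ⟩ := h.uncons
    cases hD with
    | head => cases hF; exact .refl _ _
    | tail _ hD => exact hF.subQual.trans (ih hκ hD)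

theorem compatible {P : Qual 0} {C : Colour} (h : ContTy R T κ A) (hP : SubQual Env.empty P R)
    (hC : P.eval = some C) : Compatible C κ := fun _ hD =>
  have hCR := (SubQual.toQual_of_eval _ hC).2.trans hP
  (hCR.trans (h.subQual_of_barrier_mem hD)).colourLe_of_toQual

end ContTy

/-! ### Preservation -/

namespace Config

theorem hasAnswer_barrier {P R : Qual 0} {C : Colour} {t : Tm 0 0 0} {T A : QTy 0 0} {κ : Cont}
    (hC : P.eval = some C) (hP : SubQual Env.empty P R) (ht : HasTy Env.empty P t T)
    (hκ : ContTy R T κ A) : HasAnswer ⟨t, Frame.barrier C :: κ⟩ A :=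
  have h := SubQual.toQual_of_eval Env.empty hC
  ⟨C.toQual, T, .subEff ht h.1, .barrier (h.2.trans hP) hκ⟩

theorem HasAnswer.uncons {c : Tm 0 0 0} {F : Frame} {κ : Cont} {A : QTy 0 0}
    (h : HasAnswer ⟨c, F :: κ⟩ A) :
    ∃ R T R' T', HasTy Env.empty R c T ∧ FrameTy R T F R' T' ∧ ContTy R' T' κ A := by
  obtain ⟨R, T, hc, hκ⟩ := h
  obtain ⟨T₀, R', T', hT, hF, hκ⟩ := hκ.uncons
  exact ⟨R, T₀, R', T', hc.sub hT, hF, hκ⟩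

theorem HasAnswer.exists_structural {γ : Config} {A : QTy 0 0} (h : γ.HasAnswer A) :
    ∃ R T, HasTy.Structural Env.empty R γ.c T ∧ ContTy R T γ.κ A := by
  obtain ⟨R, T, hc, hκ⟩ := h
  obtain ⟨T', hc, hT⟩ := hc.exists_structural
  exact ⟨R, T', hc, .sub hT hκ⟩

theorem HasAnswer.step {γ γ' : Config} {A : QTy 0 0} (h : γ.HasAnswer A) (hs : Step γ γ') :
    γ'.HasAnswer A := by
  cases hs with
  | pushArg =>
    have ⟨R, _, .app hs ht, hκ⟩ := h.exists_structural
    exact ⟨R, _, hs, .arg ht hκ⟩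
  | pushTArg =>
    have ⟨R, _, .tapp hs hU, hκ⟩ := h.exists_structural
    exact ⟨R, _, hs, .targ hU hκ⟩
  | pushQArg =>
    have ⟨R, _, .qapp hs hB, hκ⟩ := h.exists_structural
    exact ⟨R, _, hs, .qarg hB hκ⟩
  | pushAssert =>
    have ⟨R, _, .assertQ hs, hκ⟩ := h.exists_structural
    exact ⟨R, _, hs, .assertQ hκ⟩
  | pushUpqual =>
    have ⟨R, _, .upqual hs hQ, hκ⟩ := h.exists_structural
    exact ⟨R, _, hs, .upqual hQ hκ⟩
  | evalArg _ _ hv =>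
    have ⟨R, _, _, _, hf, .arg ht, hκ⟩ := h.uncons
    exact ⟨R, _, ht, .fn hv hf hκ⟩
  | app hv hC _ =>
    have ⟨_, _, _, _, hc, .fn hf, hκ⟩ := h.uncons
    exact hasAnswer_barrier hC (hf.tag_subQual rfl) (hf.beta hv hc) hκ
  | tapp hC _ =>
    have ⟨_, _, _, _, hf, .targ hU, hκ⟩ := h.uncons
    exact hasAnswer_barrier hC (hf.tag_subQual rfl) (hf.tbeta hU) hκ
  | qapp hC _ =>
    have ⟨_, _, _, _, hf, .qarg hB, hκ⟩ := h.uncons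
    exact hasAnswer_barrier hC (hf.tag_subQual rfl) (hf.qbeta hB) hκ
  | assertQ =>
    have ⟨R, _, _, _, hv, .assertQ, hκ⟩ := h.uncons
    exact ⟨R, _, hv, hκ⟩
  | upqual hP =>
    have ⟨R, _, _, _, hv, .upqual hQ, hκ⟩ := h.uncons
    exact ⟨R, _, hv.retag hP hQ, hκ⟩
  | popBarrier _ _ hv =>
    have ⟨_, _, R, _, hc, .barrier _, hκ⟩ := h.uncons
    exact ⟨R, _, hc.of_isValue hv R, hκ⟩

theorem HasAnswer.steps {γ γ' : Config} {A : QTy 0 0} (h : γ.HasAnswer A)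
    (hs : Relation.ReflTransGen Step γ γ') : γ'.HasAnswer A := by
  induction hs with
  | refl => exact h
  | tail _ hs ih => exact ih.step hs

theorem Calls.compatible {γ : Config} {P : Qual 0} {κ : Cont} {C : Colour} (h : γ.Calls P κ)
    (hγ : γ.WellTyped) (hC : P.eval = some C) : Compatible C κ := by
  obtain ⟨A, hγ⟩ := hγ
  cases h with
  | app =>
    have ⟨_, _, _, _, _, .fn hf, hκ⟩ := hγ.uncons
    exact hκ.compatible (hf.tag_subQual rfl) hC
  | tapp =>
    have ⟨_, _, _, _, hf, .targ _, hκ⟩ := hγ.uncons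
    exact hκ.compatible (hf.tag_subQual rfl) hC
  | qapp =>
    have ⟨_, _, _, _, hf, .qarg _, hκ⟩ := hγ.uncons
    exact hκ.compatible (hf.tag_subQual rfl) hC

end Config

end FsubA

theorem mainTheorem8 :
    (∀ (c c' : FsubA.Tm 0 0 0) (κ κ' : FsubA.Cont),
      FsubA.Config.WellTyped ⟨c, κ⟩ → FsubA.Step ⟨c, κ⟩ ⟨c', κ'⟩ →
      FsubA.Config.WellTyped ⟨c', κ'⟩) ∧
    (∀ (c c' : FsubA.Tm 0 0 0) (κ κ' : FsubA.Cont) (A : FsubA.QTy 0 0),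
      FsubA.Config.HasAnswer ⟨c, κ⟩ A → FsubA.Step ⟨c, κ⟩ ⟨c', κ'⟩ →
      FsubA.Config.HasAnswer ⟨c', κ'⟩ A) ∧
    (∀ (γ γ' : FsubA.Config) (P : FsubA.Qual 0) (κ : FsubA.Cont),
      γ.WellTyped → Relation.ReflTransGen FsubA.Step γ γ' → γ'.Calls P κ →
      P.eval = some FsubA.Colour.async → FsubA.Frame.barrier FsubA.Colour.sync ∉ κ) := by
  refine ⟨fun c c' κ κ' ⟨A, h⟩ hs => ⟨A, h.step hs⟩, fun c c' κ κ' A h hs => h.step hs, ?_⟩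
  intro γ γ' P κ ⟨A, h⟩ hs hcall hP hsync
  have hle : FsubA.Colour.Le .async .sync := hcall.compatible ⟨A, h.steps hs⟩ hP _ hsync
  nomatch hle
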